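/- Let $X$ be a scheme and $\mathfrak p\subset\mathcal O_X$ a coherent sheaf of ideals, i.e. $X$ is covered by affine open subsets $U$ such that $\Gamma(U,\mathfrak p)$ is a finitely generated ideal and $\mathfrak p|_U$ is the associated sheaf of ideals. Let $\mathcal M$ be any $\mathcal O_X$-module. Notation. For an $\mathcal O_X$-module $\mathcal N$, $\mathfrak p^n\mathcal N\subseteq\mathcal N$ is the submodule generated by the products of sections of $\mathfrak p^n$ and of $\mathcal N$ (with $\mathfrak p^0=\mathcal O_X$), and $\widehat{\mathcal N}=\varprojlim_n\mathcal N/\mathfrak p^n\mathcal N$. Let $C^0\mathcal N$ be the $\mathcal O_X$-module with $\Gamma(U,C^0\mathcal N)=\prod_{x\in U}\mathcal N_x$. Put $\mathcal N_0=\mathcal N$, let $\mathcal N_{i+1}$ be the cokernel of the canonical morphism $\mathcal N_i\to C^0\mathcal N_i$, and let $C^i\mathcal N=C^0\mathcal N_i$ be the terms of the Godement resolution of $\mathcal N$; each $C^i$ is a functor. We say that $\mathcal N$ is affinely $\mathfrak p$-acyclic if, for every affine open subset $U$ of $X$ and every integer $n\ge 0$, with $A=\Gamma(U,\mathcal O_X)$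 and $I_U=\Gamma(U,\mathfrak p)$, one has $H^j(U,\mathcal N)=0=H^j(U,\mathcal N/\mathfrak p^n\mathcal N)$ for all $j>0$ and the natural map $\Gamma(U,\mathcal N)\otimes_A A/I_U^n\to\Gamma(U,\mathcal N/\mathfrak p^n\mathcal N)$ is an isomorphism. Then: 1. For every $i\ge 0$, $\mathfrak p\,C^i\mathcal M=C^i(\mathfrak p\mathcal M)$ and $C^i\mathcal M/\mathfrak p\,C^i\mathcal M=C^i(\mathcal M/\mathfrak p\mathcal M)$. That is, there is an isomorphism $\mathfrak p\,C^i\mathcal M\cong C^i(\mathfrak p\mathcal M)$ compatible with the inclusion $\mathfrak p\,C^i\mathcal M\subseteq C^i\mathcal M$ and the morphism $C^i(\mathfrak p\mathcal M)\to C^i\mathcal M$ induced by $\mathfrak p\mathcal M\subseteq\mathcal M$, and an isomorphism $C^i\mathcal M/\mathfrak p\,C^i\mathcal M\cong C^i(\mathcal M/\mathfrak p\mathcal M)$ compatible with the projection from $C^i\mathcal M$ and the morphism induced by $\mathcal M\to\mathcal M/\mathfrak p\mathcal M$. 2. $C^0\mathcal M$ is affinely $\mathfrak p$-acyclic. 3.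 $\widehat{C^0\mathcal M}$ is flasque. If moreover $\mathfrak p$ is generated by finitely many global sections, then, with $I=\Gamma(X,\mathfrak p)$, $\Gamma(X,\widehat{C^0\mathcal M})$ is the $I$-adic completion of $\Gamma(X,C^0\mathcal M)$: there is a $\Gamma(X,\mathcal O_X)$-linear isomorphism $\varprojlim_n\Gamma(X,C^0\mathcal M)/I^n\,\Gamma(X,C^0\mathcal M)\cong\Gamma(X,\widehat{C^0\mathcal M})$ compatible, for every $n$, with the natural maps to $\Gamma(X,C^0\mathcal M/\mathfrak p^nC^0\mathcal M)$. -/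

import Mathlib

universe u

open CategoryTheory Limits TopologicalSpace Opposite AlgebraicGeometry
open scoped TensorProduct

noncomputable section

namespace AlgebraicGeometry.Scheme

/-! ### Sheaves of ideals -/

/-- A sheaf of ideals of `𝒪_X`: an ideal of `Γ(X, U)` for each open `U`, stable under restriction,
such that a function which locally belongs to the ideals belongs to them. -/
structure IdealSheaf (X : Scheme.{u}) where
  /-- The sections over an open subset. -/
  ideal (U : X.Opens) : Ideal Γ(X, U)
  map_mem {U V : X.Opens} (i : V ⟶ U) {f : Γ(X, U)} (hf : f ∈ ideal U) :
    X.presheaf.map i.op f ∈ ideal V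
  mem_of_locally {U : X.Opens} {f : Γ(X, U)}
    (hf : ∀ x ∈ U, ∃ (V : X.Opens) (i : V ⟶ U), x ∈ V ∧ X.presheaf.map i.op f ∈ ideal V) :
    f ∈ ideal U

namespace IdealSheaf

variable {X : Scheme.{u}} (𝔭 : X.IdealSheaf)

/-- A sheaf of ideals is coherent if `X` is covered by affine opens `U` on which it is the
sheaf associated with a finitely generated ideal of `Γ(X, U)`. -/
def IsCoherent : Prop :=
  ∀ x : X, ∃ U : X.Opens, IsAffineOpen U ∧ x ∈ U ∧ (𝔭.ideal U).FG ∧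
    ∀ f : Γ(X, U), 𝔭.ideal (X.basicOpen f) =
      (𝔭.ideal U).map (X.presheaf.map (homOfLE (X.basicOpen_le f)).op).hom

/-- The sheaf of ideals is generated by the set `s` of global sections: the elements of `s` are
sections of it, and each of its sections is locally a combination of elements of `s`. -/
def IsGeneratedBy (s : Set Γ(X, ⊤)) : Prop :=
  s ⊆ 𝔭.ideal ⊤ ∧ ∀ (U : X.Opens), ∀ f ∈ 𝔭.ideal U, ∀ x ∈ U, ∃ (V : X.Opens) (i : V ⟶ U), x ∈ V ∧
    X.presheaf.map i.op f ∈ Ideal.span (X.presheaf.map (homOfLE (le_top : V ≤ ⊤)).op '' s)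

lemma map_pow_mem (n : ℕ) {U V W : X.Opens} (j : W ⟶ V) (i : V ⟶ U) {k : W ⟶ U}
    {f : Γ(X, U)} (hf : X.presheaf.map i.op f ∈ 𝔭.ideal V ^ n) :
    X.presheaf.map k.op f ∈ 𝔭.ideal W ^ n := by
  have h : 𝔭.ideal V ^ n ≤ (𝔭.ideal W ^ n).comap (X.presheaf.map j.op).hom :=
    (Ideal.pow_right_mono (fun _ h ↦ 𝔭.map_mem j h) n).trans (Ideal.le_comap_pow _ n)
  have := h hf
  rw [Ideal.mem_comap, ← CommRingCat.comp_apply, ← Functor.map_comp, ← op_comp] at this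
  exact this

/-- The power `𝔭 ^ n`: the sheaf generated by the presheaf of ideals `U ↦ 𝔭(U) ^ n`. -/
def pow (n : ℕ) : X.IdealSheaf where
  ideal U :=
    { carrier := {f | ∀ x ∈ U, ∃ (V : X.Opens) (i : V ⟶ U), x ∈ V ∧
        X.presheaf.map i.op f ∈ 𝔭.ideal V ^ n}
      zero_mem' := fun x hx ↦ ⟨U, 𝟙 U, hx, by simp⟩
      add_mem' := by
        intro f g hf hg x hx
        obtain ⟨V, i, hV, hf⟩ := hf x hx
        obtain ⟨W, j, hW, hg⟩ := hg x hx
        refine ⟨V ⊓ W, Opens.infLELeft V W ≫ i, ⟨hV, hW⟩, ?_⟩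
        rw [map_add]
        refine add_mem ?_ ?_
        · exact 𝔭.map_pow_mem n (Opens.infLELeft V W) i hf
        · exact 𝔭.map_pow_mem n (Opens.infLERight V W) j hg
      smul_mem' := by
        intro r f hf x hx
        obtain ⟨V, i, hV, hf⟩ := hf x hx
        exact ⟨V, i, hV, by simpa using Ideal.mul_mem_left _ _ hf⟩ }
  map_mem := by
    intro U V i f hf x hx
    obtain ⟨W, j, hW, hf⟩ := hf x (leOfHom i hx)
    refine ⟨V ⊓ W, Opens.infLELeft V W, ⟨hx, hW⟩, ?_⟩
    rw [← CommRingCat.comp_apply, ← Functor.map_comp, ← op_comp]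
    exact 𝔭.map_pow_mem n (Opens.infLERight V W) j hf
  mem_of_locally := by
    intro U f hf x hx
    obtain ⟨V, i, hV, hf⟩ := hf x hx
    obtain ⟨W, j, hW, hf⟩ := hf x hV
    refine ⟨W, j ≫ i, hW, ?_⟩
    rwa [op_comp, Functor.map_comp, CommRingCat.comp_apply]
end IdealSheaf

namespace Modules

variable {X : Scheme.{u}}

/-- A morphism of `𝒪_X`-modules on the sections over `U`, as a linear map. -/
def appLinear {M N : X.Modules} (φ : M ⟶ N) (U : X.Opens) : Γ(M, U) →ₗ[Γ(X, U)] Γ(N, U) where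
  toFun s := φ.app U s
  map_add' _ _ := map_add _ _ _
  map_smul' r s := Hom.app_smul φ r s

/-- The sheaf of abelian groups underlying an `𝒪_X`-module. -/
def abSheaf (M : X.Modules) : Sheaf (Opens.grothendieckTopology X) AddCommGrpCat.{u} :=
  ⟨M.presheaf, M.isSheaf⟩

/-- `M` is acyclic on the open subset `U` if `H^j(U, M) = 0` for all `j > 0`. -/
def IsAcyclicOn (M : X.Modules) (U : X.Opens) : Prop :=
  ∀ j : ℕ, 0 < j → Subsingleton (Sheaf.H'.{u} M.abSheaf j U)

end Modules

namespace IdealSheaf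

variable {X : Scheme.{u}} (𝔭 : X.IdealSheaf)

/-! ### The module `𝔭 M` and the quotient `M / 𝔭 M` -/

variable (M : X.Modules)

lemma map_smul_mem {U V W : X.Opens} (j : W ⟶ V) (i : V ⟶ U) {k : W ⟶ U}
    {s : Γ(M, U)} (hs : M.presheaf.map i.op s ∈ 𝔭.ideal V • (⊤ : Submodule Γ(X, V) Γ(M, V))) :
    M.presheaf.map k.op s ∈ 𝔭.ideal W • (⊤ : Submodule Γ(X, W) Γ(M, W)) := by
  have key : ∀ t ∈ 𝔭.ideal V • (⊤ : Submodule Γ(X, V) Γ(M, V)),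
      M.presheaf.map j.op t ∈ 𝔭.ideal W • (⊤ : Submodule Γ(X, W) Γ(M, W)) := by
    intro t ht
    induction ht using Submodule.smul_induction_on' with
    | smul r hr m _ =>
      rw [Modules.map_smul]
      exact Submodule.smul_mem_smul (𝔭.map_mem j hr) trivial
    | add a _ b _ ha hb =>
      rw [map_add]
      exact add_mem ha hb
  have := key _ hs
  rw [← AddCommGrpCat.comp_apply, ← Functor.map_comp, ← op_comp] at this
  exact this

/-- The sections of `𝔭 M` over `U`: the sections of `M` which locally belong to `𝔭(V) M(V)`. -/
def smulSections (U : X.Opens) : Submodule Γ(X, U) Γ(M, U) where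
  carrier := {s | ∀ x ∈ U, ∃ (V : X.Opens) (i : V ⟶ U), x ∈ V ∧
    M.presheaf.map i.op s ∈ 𝔭.ideal V • (⊤ : Submodule Γ(X, V) Γ(M, V))}
  zero_mem' := fun x hx ↦ ⟨U, 𝟙 _, hx, by rw [map_zero]; exact Submodule.zero_mem _⟩
  add_mem' := by
    intro s t hs ht x hx
    obtain ⟨V, i, hV, hs⟩ := hs x hx
    obtain ⟨W, j, hW, ht⟩ := ht x hx
    refine ⟨V ⊓ W, Opens.infLELeft V W ≫ i, ⟨hV, hW⟩, ?_⟩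
    rw [map_add]
    refine add_mem ?_ ?_
    · exact 𝔭.map_smul_mem M (Opens.infLELeft V W) i hs
    · exact 𝔭.map_smul_mem M (Opens.infLERight V W) j ht
  smul_mem' := by
    intro r s hs x hx
    obtain ⟨V, i, hV, hs⟩ := hs x hx
    refine ⟨V, i, hV, ?_⟩
    rw [Modules.map_smul]
    exact Submodule.smul_mem _ _ hs

lemma map_mem_smulSections {U V : X.Opens} (i : V ⟶ U) {s : Γ(M, U)}
    (hs : s ∈ 𝔭.smulSections M U) : M.presheaf.map i.op s ∈ 𝔭.smulSections M V := by
  intro x hx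
  obtain ⟨W, j, hW, hs⟩ := hs x (leOfHom i hx)
  refine ⟨V ⊓ W, Opens.infLELeft V W, ⟨hx, hW⟩, ?_⟩
  rw [← AddCommGrpCat.comp_apply, ← Functor.map_comp, ← op_comp]
  exact 𝔭.map_smul_mem M (Opens.infLERight V W) j hs

lemma mem_smulSections_of_locally {U : X.Opens} {s : Γ(M, U)}
    (hs : ∀ x ∈ U, ∃ (V : X.Opens) (i : V ⟶ U), x ∈ V ∧
      M.presheaf.map i.op s ∈ 𝔭.smulSections M V) : s ∈ 𝔭.smulSections M U := by
  intro x hx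
  obtain ⟨V, i, hV, hs⟩ := hs x hx
  obtain ⟨W, j, hW, hs⟩ := hs x hV
  refine ⟨W, j ≫ i, hW, ?_⟩
  rwa [op_comp, Functor.map_comp, AddCommGrpCat.comp_apply]

/-- `𝔭 M` as a presheaf of submodules of `M`. -/
def smulSubmodule : PresheafOfModules.Submodule M.val where
  obj U := 𝔭.smulSections M U.unop
  map i _ hs := 𝔭.map_mem_smulSections M i.unop hs

/-- The `𝒪_X`-module `𝔭 M`, a submodule of `M`. -/
def smul : X.Modules where
  val := (𝔭.smulSubmodule M).toPresheafOfModules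
  isSheaf := by
    refine (TopCat.Presheaf.isSheaf_iff_isSheafUniqueGluing _).mpr ?_
    intro ι U sf hsf
    let sf' (i : ι) : Γ(M, U i) := (sf i).1
    have hsf' : TopCat.Presheaf.IsCompatible M.presheaf U sf' :=
      fun i j ↦ congr_arg Subtype.val (hsf i j)
    obtain ⟨s, hs, hs'⟩ := TopCat.Presheaf.IsSheaf.isSheafUniqueGluing M.isSheaf U sf' hsf'
    have mem : s ∈ 𝔭.smulSections M (iSup U) := by
      refine 𝔭.mem_smulSections_of_locally M fun x hx ↦ ?_
      obtain ⟨i, hi⟩ := Opens.mem_iSup.mp hx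
      refine ⟨U i, Opens.leSupr U i, hi, ?_⟩
      have := hs i
      rw [this]
      exact (sf i).2
    exact ⟨⟨s, mem⟩, fun i ↦ Subtype.ext (hs i),
      fun t ht ↦ Subtype.ext (hs' t.1 fun i ↦ congr_arg Subtype.val (ht i))⟩

/-- The inclusion of `𝔭 M` in `M`. -/
def smulι : 𝔭.smul M ⟶ M := ⟨(𝔭.smulSubmodule M).ι⟩

/-- The quotient `M / 𝔭 M`. -/
def quotient : X.Modules := cokernel (𝔭.smulι M)

/-- The projection of `M` onto `M / 𝔭 M`. -/
def quotientπ : M ⟶ 𝔭.quotient M := cokernel.π (𝔭.smulι M)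

lemma smulι_quotientπ : 𝔭.smulι M ≫ 𝔭.quotientπ M = 0 := cokernel.condition _

lemma quotientπ_app_eq_zero {U : X.Opens} {s : Γ(M, U)} (hs : s ∈ 𝔭.smulSections M U) :
    (𝔭.quotientπ M).app U s = 0 := by
  have h := congr_arg (fun φ ↦ Modules.Hom.app φ U) (𝔭.smulι_quotientπ M)
  exact congr($h (⟨s, hs⟩ : 𝔭.smulSections M U))

/-! ### Completion -/

lemma ideal_pow_succ_le (n : ℕ) (U : X.Opens) : (𝔭.pow (n + 1)).ideal U ≤ (𝔭.pow n).ideal U := by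
  intro f hf x hx
  obtain ⟨V, i, hV, hf⟩ := hf x hx
  exact ⟨V, i, hV, Ideal.pow_le_pow_right n.le_succ hf⟩

lemma smulSections_mono {𝔭 𝔮 : X.IdealSheaf} (h : ∀ U, 𝔭.ideal U ≤ 𝔮.ideal U) (U : X.Opens) :
    𝔭.smulSections M U ≤ 𝔮.smulSections M U := by
  intro s hs x hx
  obtain ⟨V, i, hV, hs⟩ := hs x hx
  exact ⟨V, i, hV, Submodule.smul_mono_left (h V) hs⟩

/-- The projection `M / 𝔭ⁿ⁺¹ M ⟶ M / 𝔭ⁿ M`. -/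
def transition (n : ℕ) : (𝔭.pow (n + 1)).quotient M ⟶ (𝔭.pow n).quotient M :=
  cokernel.desc _ ((𝔭.pow n).quotientπ M) (by
    ext U s
    exact (𝔭.pow n).quotientπ_app_eq_zero M
      (smulSections_mono M (𝔭.ideal_pow_succ_le n) U s.2))

/-- The inverse system of the `M / 𝔭ⁿ M`. -/
def tower : ℕᵒᵖ ⥤ X.Modules :=
  Functor.ofOpSequence (X := fun n ↦ (𝔭.pow n).quotient M) (𝔭.transition M)

/-- The `𝔭`-adic completion of `M`: the limit of the `M / 𝔭ⁿ M` in the category of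
`𝒪_X`-modules. -/
def completion : X.Modules := limit (𝔭.tower M)

/-- The projection of the completion of `M` onto `M / 𝔭ⁿ M`. -/
def completionπ (n : ℕ) : 𝔭.completion M ⟶ (𝔭.pow n).quotient M := limit.π (𝔭.tower M) (op n)

/-- The natural map `Γ(U, M) / Iⁿ Γ(U, M) → Γ(U, M / 𝔭ⁿ M)`, where `I = Γ(U, 𝔭)`. -/
def sectionsQuotientMap (n : ℕ) (U : X.Opens) :
    (Γ(M, U) ⧸ (𝔭.ideal U ^ n • (⊤ : Submodule Γ(X, U) Γ(M, U)))) →ₗ[Γ(X, U)]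
      Γ((𝔭.pow n).quotient M, U) :=
  Submodule.liftQ _ (Modules.appLinear ((𝔭.pow n).quotientπ M) U) (by
    rw [Submodule.smul_le]
    intro r hr m _
    refine (𝔭.pow n).quotientπ_app_eq_zero M fun x hx ↦ ⟨U, 𝟙 U, hx, ?_⟩
    have hr' : r ∈ (𝔭.pow n).ideal U := fun y hy ↦ ⟨U, 𝟙 U, hy, by simpa using hr⟩
    simpa using Submodule.smul_mem_smul hr' (Submodule.mem_top (x := m)))

/-- The natural map `Γ(U, M) ⊗ A / Iⁿ → Γ(U, M / 𝔭ⁿ M)`, where `A = Γ(X, U)` and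
`I = Γ(U, 𝔭)`. -/
def sectionsTensorMap (n : ℕ) (U : X.Opens) :
    Γ(M, U) ⊗[Γ(X, U)] (Γ(X, U) ⧸ 𝔭.ideal U ^ n) →ₗ[Γ(X, U)] Γ((𝔭.pow n).quotient M, U) :=
  𝔭.sectionsQuotientMap M n U ∘ₗ
    (TensorProduct.tensorQuotEquivQuotSMul Γ(M, U) (𝔭.ideal U ^ n)).toLinearMap

/-- `M` is affinely `𝔭`-acyclic: for every affine open `U` and every `n`, the sheaves `M` and
`M / 𝔭ⁿ M` are acyclic on `U` and `Γ(U, M) ⊗ A / Iⁿ → Γ(U, M / 𝔭ⁿ M)` is an isomorphism. -/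
def IsAffinelyAcyclic : Prop :=
  ∀ U : X.Opens, IsAffineOpen U → ∀ n : ℕ,
    M.IsAcyclicOn U ∧ ((𝔭.pow n).quotient M).IsAcyclicOn U ∧
      Function.Bijective (𝔭.sectionsTensorMap M n U)

end IdealSheaf

/-! ### The Godement resolution -/

namespace Modules

variable {X : Scheme.{u}}

/-- A presheaf of modules over the sheaf of commutative rings `𝒪_X`. -/
abbrev commVal (M : X.Modules) :
    _root_.PresheafOfModules.{u} (X.presheaf ⋙ forget₂ CommRingCat RingCat) := M.val

/-- The module structure of the stalk of a presheaf of modules. -/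
@[reducible]
def presheafStalkModule {Y : TopCat.{u}} {R : Y.Presheaf CommRingCat.{u}}
    (M : _root_.PresheafOfModules.{u} (R ⋙ forget₂ CommRingCat RingCat)) (y : Y) :
    Module (R.stalk y) ↑(TopCat.Presheaf.stalk M.presheaf y) :=
  inferInstance

/-- The module structure of the stalk of `M` at `x` over the local ring of `X` at `x`. -/
@[reducible]
def stalkModule (M : X.Modules) (x : X) : Module (X.presheaf.stalk x) (M.presheaf.stalk x) :=
  presheafStalkModule M.commVal x

/-- `Γ(X, U)` acts on the stalk of `M` at a point of `U`. -/
@[reducible]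
def sectionsStalkModule (M : X.Modules) (U : X.Opens) (x : U) :
    Module Γ(X, U) (M.presheaf.stalk x.1) :=
  letI := M.stalkModule x.1
  Module.compHom _ (X.presheaf.germ U x.1 x.2).hom

attribute [local instance] sectionsStalkModule

lemma germ_smul (M : X.Modules) (U : X.Opens) (x : U) (V : X.Opens) (i : V ⟶ U) (hx : x.1 ∈ V)
    (r : Γ(X, U)) (m : Γ(M, V)) :
    M.presheaf.germ V x.1 hx (X.presheaf.map i.op r • m) = r • M.presheaf.germ V x.1 hx m := by
  let := M.stalkModule x.1
  refine (PresheafOfModules.germ_smul M.commVal x.1 V hx (X.presheaf.map i.op r) m).trans ?_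
  rw [TopCat.Presheaf.germ_res_apply]
  rfl

lemma smul_stalk (M : X.Modules) {U V : X.Opens} (i : V ⟶ U) (x : V) (r : Γ(X, U))
    (m : M.presheaf.stalk x.1) :
    letI := M.sectionsStalkModule U ⟨x.1, leOfHom i x.2⟩
    letI := M.sectionsStalkModule V x
    r • m = X.presheaf.map i.op r • m := by
  let := M.stalkModule x.1
  change X.presheaf.germ U x.1 _ r • m = X.presheaf.germ V x.1 _ (X.presheaf.map i.op r) • m
  rw [TopCat.Presheaf.germ_res_apply]

/-- The presheaf `U ↦ ∏_{x ∈ U} M_x`, whose restriction maps are the projections. -/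
def godementPresheaf (M : X.Modules) : TopCat.Presheaf Ab X where
  obj U := AddCommGrpCat.of (∀ x : U.unop, M.presheaf.stalk x.1)
  map i := AddCommGrpCat.ofHom
    { toFun s x := s ⟨x.1, leOfHom i.unop x.2⟩
      map_zero' := rfl
      map_add' _ _ := rfl }

instance (M : X.Modules) (U : X.Opensᵒᵖ) :
    Module (X.ringCatSheaf.obj.obj U) (M.godementPresheaf.obj U) :=
  inferInstanceAs (Module Γ(X, U.unop) (∀ x : U.unop, M.presheaf.stalk x.1))

/-- The sheaf `C⁰ M` of discontinuous sections of `M`: `Γ(U, C⁰ M) = ∏_{x ∈ U} M_x`. -/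
def godementZero (M : X.Modules) : X.Modules where
  val := PresheafOfModules.ofPresheaf M.godementPresheaf (by
    intro U V i r s
    funext x
    exact M.smul_stalk i.unop x r (s ⟨x.1, leOfHom i.unop x.2⟩))
  isSheaf := by
    refine (TopCat.Presheaf.isSheaf_iff_isSheaf_comp (CategoryTheory.forget Ab) M.godementPresheaf).mpr ?_
    exact TopCat.Presheaf.toTypes_isSheaf X.toTopCat (fun x ↦ M.presheaf.stalk x)

/-- The canonical morphism `M ⟶ C⁰ M`, which maps a section to the family of its germs. -/
def toGodementZero (M : X.Modules) : M ⟶ M.godementZero where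
  val := PresheafOfModules.homMk
    { app U := AddCommGrpCat.ofHom
        { toFun s x := M.presheaf.germ U.unop x.1 x.2 s
          map_zero' := by funext x; exact map_zero _
          map_add' s t := by funext x; exact map_add _ _ _ }
      naturality U V i := by
        ext s
        funext x
        exact TopCat.Presheaf.germ_res_apply M.presheaf i.unop x.1 x.2 s }
    (by
      intro U r s
      funext x
      have := M.germ_smul U.unop x U.unop (𝟙 _) x.2 r s
      rw [op_id, CategoryTheory.Functor.map_id] at this
      exact this)

lemma stalkMap_smul {M N : X.Modules} (φ : M ⟶ N) (U : X.Opens) (x : U) (r : Γ(X, U))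
    (m : M.presheaf.stalk x.1) :
    (TopCat.Presheaf.stalkFunctor Ab x.1).map φ.mapPresheaf (r • m) =
      HSMul.hSMul (α := Γ(X, U)) (β := N.presheaf.stalk x.1) r
        ((TopCat.Presheaf.stalkFunctor Ab x.1).map φ.mapPresheaf m) := by
  obtain ⟨V, hV, s, rfl⟩ := TopCat.Presheaf.exists_germ_eq M.presheaf m
  obtain ⟨W, i, j, hW⟩ : ∃ (W : X.Opens) (_ : W ⟶ U) (_ : W ⟶ V), x.1 ∈ W :=
    ⟨U ⊓ V, Opens.infLELeft U V, Opens.infLERight U V, x.2, hV⟩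
  rw [← TopCat.Presheaf.germ_res_apply M.presheaf j x.1 hW s, ← germ_smul M U x W i hW,
    TopCat.Presheaf.stalkFunctor_map_germ_apply, TopCat.Presheaf.stalkFunctor_map_germ_apply,
    ← germ_smul N U x W i hW]
  exact congr_arg _ (Hom.app_smul φ _ _)

/-- The morphism `C⁰ M ⟶ C⁰ N` induced by a morphism `M ⟶ N`: it is the product of the maps
induced on stalks. -/
def godementZeroMap {M N : X.Modules} (φ : M ⟶ N) : M.godementZero ⟶ N.godementZero where
  val := PresheafOfModules.homMk
    { app U := AddCommGrpCat.ofHom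
        { toFun s x := (TopCat.Presheaf.stalkFunctor Ab x.1).map φ.mapPresheaf (s x)
          map_zero' := by funext x; exact map_zero _
          map_add' s t := by funext x; exact map_add _ _ _ }
      naturality U V i := rfl }
    (by
      intro U r s
      funext x
      exact stalkMap_smul φ U.unop x r (s x))

lemma toGodementZero_naturality {M N : X.Modules} (φ : M ⟶ N) :
    φ ≫ N.toGodementZero = M.toGodementZero ≫ godementZeroMap φ := by
  ext U s
  funext x
  exact (TopCat.Presheaf.stalkFunctor_map_germ_apply U x.1 x.2 φ.mapPresheaf s).symm

lemma godementZeroMap_id (M : X.Modules) : godementZeroMap (𝟙 M) = 𝟙 M.godementZero := by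
  ext U s
  funext x
  exact congr($((TopCat.Presheaf.stalkFunctor Ab x.1).map_id M.presheaf) (s x))

lemma godementZeroMap_comp {M N K : X.Modules} (φ : M ⟶ N) (ψ : N ⟶ K) :
    godementZeroMap (φ ≫ ψ) = godementZeroMap φ ≫ godementZeroMap ψ := by
  ext U s
  funext x
  exact congr($((TopCat.Presheaf.stalkFunctor Ab x.1).map_comp
    φ.mapPresheaf ψ.mapPresheaf) (s x))

/-- The functor `C⁰` on `𝒪_X`-modules. -/
def godementZeroFunctor : X.Modules ⥤ X.Modules where
  obj M := M.godementZero
  map φ := godementZeroMap φ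
  map_id M := godementZeroMap_id M
  map_comp φ ψ := godementZeroMap_comp φ ψ

/-- The functor `M ↦ M₁`, where `M₁` is the cokernel of `M ⟶ C⁰ M`. -/
def godementCokernel : X.Modules ⥤ X.Modules where
  obj M := cokernel M.toGodementZero
  map {M N} φ := cokernel.map M.toGodementZero N.toGodementZero φ (godementZeroMap φ)
    (toGodementZero_naturality φ).symm
  map_id M := by
    rw [← cancel_epi (cokernel.π _)]
    simp [godementZeroMap_id]
  map_comp {M N K} φ ψ := by
    rw [← cancel_epi (cokernel.π _)]
    simp [godementZeroMap_comp]

/-- The functor `M ↦ Mᵢ`, where `M₀ = M` and `Mᵢ₊₁` is the cokernel of `Mᵢ ⟶ C⁰ Mᵢ`. -/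
def godementSyzygy : ℕ → (X.Modules ⥤ X.Modules)
  | 0 => 𝟭 _
  | i + 1 => godementSyzygy i ⋙ godementCokernel

/-- The `i`-th term `Cⁱ` of the Godement resolution, as a functor: `Cⁱ M = C⁰ Mᵢ`. -/
def godement (i : ℕ) : X.Modules ⥤ X.Modules := godementSyzygy i ⋙ godementZeroFunctor

end Modules

end AlgebraicGeometry.Scheme

end

/-!
Everything reduces to statements about sections and germs. A section of `C⁰ M` over `U` is an
arbitrary family of elements of the stalks `M_x`, so it can be built point by point and extended
by zero.

*Multiplication by `𝔭`.* Let `J` be a finitely generated ideal of `Γ(X, U)` which generates `𝔭`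
on `U`. If all the components of a section `s` of `C⁰ M` over `U` come from the stalks of `𝔭 M`,
then each of them is a combination of the finitely many generators of `J` with coefficients in
`M_x`; taking for each generator the family of its coefficients shows that `s` belongs to
`J Γ(U, C⁰ M)` (`IsGeneratedOn.mem_smul_top_godementZero`). Thus `𝔭 C⁰ M = C⁰ (𝔭 M)`. Since `C⁰` is
exact, and `M ↦ M₁ = coker (M ⟶ C⁰ M)` is exact by the snake lemma, both functors commute with
`M ↦ 𝔭 M` and with `M ↦ M / 𝔭 M`; this property (`CommutesWithSmul`) is stable under composition,
which gives the statement for all `Cⁱ`.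

*Acyclicity.* `C⁰ M` and its quotient `C⁰ M / 𝔭ⁿ C⁰ M = C⁰ (M / 𝔭ⁿ M)` are flasque, and flasque
abelian sheaves are acyclic (`subsingleton_H'_of_isFlasque`). On an affine open subset `U`, a
coherent sheaf of ideals is generated by the finitely generated ideal `I = Γ(U, 𝔭)`
(`IsCoherent.isTildeOn`, an application of the affine communication lemma). Then `𝔭ⁿ` is generated
on `U` by `Iⁿ`, so that the kernel of the surjection `Γ(U, C⁰ M) → Γ(U, C⁰ M / 𝔭ⁿ C⁰ M)` is
`Iⁿ Γ(U, C⁰ M)` (`IsLocallyFG.sectionsQuotientMap_bijective`).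

*Completion.* A section of the completion of `C⁰ M` is a compatible sequence of sections of the
`C⁰ M / 𝔭ⁿ C⁰ M`. Extending by zero lifts of these to `C⁰ M` gives a compatible sequence again, so
that the completion is flasque. When finitely many global sections generate `𝔭`, with `I = Γ(X, 𝔭)`, the maps
`Γ(X, C⁰ M) / Iⁿ Γ(X, C⁰ M) → Γ(X, C⁰ M / 𝔭ⁿ C⁰ M)` are bijective, for the same reason as on affine
open subsets, and their limit is the required isomorphism (`exists_adicCompletion_equiv`).
-/

noncomputable section

/-! ### Flasque sheaves are acyclic -/

namespace TopCat.Sheaf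

variable {Y : TopCat.{u}}

/-- The functor sending a presheaf of sets to the abelian sheaf freely generated by it. -/
def freeSheafFunctor (Y : TopCat.{u}) : ((Opens Y)ᵒᵖ ⥤ Type u) ⥤ TopCat.Sheaf AddCommGrpCat.{u} Y :=
  (Functor.whiskeringRight _ _ _).obj AddCommGrpCat.free ⋙
    presheafToSheaf (Opens.grothendieckTopology Y) _

/-- The abelian sheaf `ℤ_U` on `Y` freely generated by the sheaf of sets represented by `U`:
the sheaf cohomology groups `H'` are the `Ext`-groups out of it. -/
def freeSheaf (Y : TopCat.{u}) : Opens Y ⥤ TopCat.Sheaf AddCommGrpCat.{u} Y :=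
  yoneda ⋙ freeSheafFunctor Y

/-- The free abelian sheaf functor is left adjoint to the forgetful functor. -/
def freeSheafAdjunction (Y : TopCat.{u}) : freeSheafFunctor Y ⊣
    sheafToPresheaf (Opens.grothendieckTopology Y) AddCommGrpCat.{u} ⋙
      (Functor.whiskeringRight _ _ _).obj (CategoryTheory.forget AddCommGrpCat.{u}) :=
  (AddCommGrpCat.adj.whiskerRight (Opens Y)ᵒᵖ).comp
    (sheafificationAdjunction (Opens.grothendieckTopology Y) AddCommGrpCat.{u})

/-- Morphisms from `ℤ_U` to an abelian sheaf are the sections of that sheaf over `U`. -/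
def freeSheafHomEquiv (U : Opens Y) (F : TopCat.Sheaf AddCommGrpCat.{u} Y) :
    ((freeSheaf Y).obj U ⟶ F) ≃ F.obj.obj (op U) :=
  ((freeSheafAdjunction Y).homEquiv (yoneda.obj U) F).trans yonedaEquiv

lemma freeSheafHomEquiv_comp (U : Opens Y) {F G : TopCat.Sheaf AddCommGrpCat.{u} Y} (g : F ⟶ G)
    (a : (freeSheaf Y).obj U ⟶ F) :
    freeSheafHomEquiv U G (a ≫ g) = g.hom.app (op U) (freeSheafHomEquiv U F a) :=
  congr_arg yonedaEquiv ((freeSheafAdjunction Y).homEquiv_naturality_right a g)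

lemma freeSheafHomEquiv_map {U V : Opens Y} (i : V ⟶ U) {F : TopCat.Sheaf AddCommGrpCat.{u} Y}
    (a : (freeSheaf Y).obj U ⟶ F) :
    freeSheafHomEquiv V F ((freeSheaf Y).map i ≫ a) =
      F.obj.map i.op (freeSheafHomEquiv U F a) :=
  (congr_arg yonedaEquiv
    ((freeSheafAdjunction Y).homEquiv_naturality_left (yoneda.map i) a)).trans
    (yonedaEquiv_naturality _ i).symm

instance mono_freeSheaf_map {U V : Opens Y} (i : V ⟶ U) : Mono ((freeSheaf Y).map i) := by
  have : Mono (((Functor.whiskeringRight (Opens Y)ᵒᵖ _ _).obj AddCommGrpCat.free.{u}).map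
      (yoneda.map i)) := by
    rw [NatTrans.mono_iff_mono_app]
    intro W
    exact AddCommGrpCat.free.map_mono ((yoneda.map i).app W)
  exact inferInstanceAs (Mono ((presheafToSheaf (Opens.grothendieckTopology Y) _).map _))

/-- An injective abelian sheaf is flasque, since `ℤ_V ⟶ ℤ_U` is a monomorphism. -/
lemma isFlasque_of_injective (F : TopCat.Sheaf AddCommGrpCat.{u} Y) [Injective F] :
    F.IsFlasque where
  epi {U V} i := by
    rw [AddCommGrpCat.epi_iff_surjective]
    intro s
    let j : V.unop ⟶ U.unop := i.unop
    refine ⟨freeSheafHomEquiv U.unop F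
      (Injective.factorThru ((freeSheafHomEquiv V.unop F).symm s) ((freeSheaf Y).map j)), ?_⟩
    exact (freeSheafHomEquiv_map j _).symm.trans (by simp)

/-- A flasque sheaf is the kernel of an epimorphism from an injective sheaf to a flasque one. -/
lemma IsFlasque.exists_shortExact (F : TopCat.Sheaf AddCommGrpCat.{u} Y) [F.IsFlasque] :
    ∃ (I Q : TopCat.Sheaf AddCommGrpCat.{u} Y) (f : F ⟶ I) (g : I ⟶ Q) (w : f ≫ g = 0),
      Injective I ∧ Q.IsFlasque ∧ (ShortComplex.mk f g w).ShortExact := by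
  let S : ShortComplex (TopCat.Sheaf AddCommGrpCat.{u} Y) :=
    ShortComplex.mk (Injective.ι F) (cokernel.π _) (cokernel.condition _)
  have hS : S.ShortExact :=
    { exact := ShortComplex.exact_cokernel _
      mono_f := inferInstanceAs (Mono (Injective.ι F))
      epi_g := inferInstanceAs (Epi (cokernel.π (Injective.ι F))) }
  have : TopCat.Sheaf.IsFlasque S.X₁ := ‹F.IsFlasque›
  have : TopCat.Sheaf.IsFlasque S.X₂ := isFlasque_of_injective (Injective.under F)
  exact ⟨_, _, _, _, _, inferInstanceAs (Injective (Injective.under F)),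
    IsFlasque.of_shortExact_of_isFlasque₁₂ hS, hS⟩

open CategoryTheory.Abelian in
/-- Dimension shifting: embed `F` in an injective sheaf `I`. As `I` is flasque, so is `I / F`,
and the sections of `I / F` lift to `I`. -/
theorem ext_freeSheaf_eq_zero (U : Opens Y) (n : ℕ) :
    ∀ (F : TopCat.Sheaf AddCommGrpCat.{u} Y) [F.IsFlasque]
      (x : Ext.{u} ((freeSheaf Y).obj U) F (n + 1)), x = 0 := by
  induction n with
  | zero =>
    intro F _ x
    obtain ⟨I, Q, f, g, w, _, _, hS⟩ := IsFlasque.exists_shortExact F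
    obtain ⟨y, rfl⟩ :=
      Ext.covariant_sequence_exact₁ _ hS x (Ext.eq_zero_of_injective _) (zero_add 1)
    obtain ⟨y, rfl⟩ := (Ext.mk₀_bijective _ _).2 y
    have : TopCat.Sheaf.IsFlasque (ShortComplex.mk f g w).X₁ := ‹F.IsFlasque›
    obtain ⟨t, ht⟩ := (AddCommGrpCat.epi_iff_surjective _).mp
      (IsFlasque.epi_of_shortExact hS) (freeSheafHomEquiv U _ y)
    obtain rfl : (freeSheafHomEquiv U _).symm t ≫ g = y := by
      apply (freeSheafHomEquiv U _).injective
      rw [freeSheafHomEquiv_comp, Equiv.apply_symm_apply]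
      exact ht
    rw [← Ext.mk₀_comp_mk₀, Ext.comp_assoc_of_second_deg_zero,
      ShortComplex.ShortExact.comp_extClass hS, Ext.comp_zero]
  | succ n ih =>
    intro F _ x
    obtain ⟨I, Q, f, g, w, _, _, hS⟩ := IsFlasque.exists_shortExact F
    obtain ⟨y, rfl⟩ := Ext.covariant_sequence_exact₁ _ hS x (Ext.eq_zero_of_injective _) rfl
    rw [ih _ y, Ext.zero_comp]

lemma subsingleton_H'_of_isFlasque (F : TopCat.Sheaf AddCommGrpCat.{u} Y) [F.IsFlasque]
    (U : Opens Y) {j : ℕ} (hj : 0 < j) :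
    Subsingleton (CategoryTheory.Sheaf.H'.{u} F j U) := by
  obtain ⟨n, rfl⟩ := Nat.exists_eq_add_of_lt hj
  rw [zero_add]
  refine ⟨fun x y ↦ ?_⟩
  exact (ext_freeSheaf_eq_zero U n F x).trans (ext_freeSheaf_eq_zero U n F y).symm

end TopCat.Sheaf

namespace AlgebraicGeometry.Scheme

namespace Modules

variable {X : Scheme.{u}} {M N K : X.Modules}

/-! ### Sections of `𝒪_X`-modules and exactness -/

lemma map_map (M : X.Modules) {U V W : X.Opens} (i : V ⟶ U) (j : W ⟶ V) (k : W ⟶ U)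
    (s : Γ(M, U)) :
    M.presheaf.map j.op (M.presheaf.map i.op s) = M.presheaf.map k.op s := by
  rw [← AddCommGrpCat.comp_apply, ← Functor.map_comp, ← op_comp]
  rfl

lemma map_id_apply (M : X.Modules) {U : X.Opens} (i : U ⟶ U) (s : Γ(M, U)) :
    M.presheaf.map i.op s = s := by
  rw [Subsingleton.elim i (𝟙 U)]
  simp

lemma app_map (φ : M ⟶ N) {U V : X.Opens} (i : V ⟶ U) (s : Γ(M, U)) :
    φ.app V (M.presheaf.map i.op s) = N.presheaf.map i.op (φ.app U s) :=
  congr($(φ.mapPresheaf.naturality i.op) s)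

lemma eq_of_locally_eq {U : X.Opens} {s t : Γ(M, U)}
    (h : ∀ x ∈ U, ∃ (V : X.Opens) (i : V ⟶ U), x ∈ V ∧
      M.presheaf.map i.op s = M.presheaf.map i.op t) : s = t := by
  refine TopCat.Presheaf.section_ext M.abSheaf U s t fun x hx ↦ ?_
  obtain ⟨V, i, hV, e⟩ := h x hx
  change M.presheaf.germ U x hx s = M.presheaf.germ U x hx t
  rw [← TopCat.Presheaf.germ_res_apply M.presheaf i x hV, e, TopCat.Presheaf.germ_res_apply]

/-- A morphism of `𝒪_X`-modules is locally surjective if every section of the target locally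
lifts to the source. -/
def IsLocallySurjective (φ : M ⟶ N) : Prop :=
  ∀ (U : X.Opens) (s : Γ(N, U)), ∀ x ∈ U, ∃ (V : X.Opens) (i : V ⟶ U), x ∈ V ∧
    ∃ t : Γ(M, V), φ.app V t = N.presheaf.map i.op s

lemma mono_of_injective {φ : M ⟶ N} (h : ∀ U, Function.Injective (φ.app U)) : Mono φ where
  right_cancellation f g e := by
    ext U s
    exact h U congr(($e).app U s)

lemma app_injective (φ : M ⟶ N) [Mono φ] (U : X.Opens) : Function.Injective (φ.app U) := by
  have : Mono ((toPresheaf X).map φ) := inferInstance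
  exact (AddCommGrpCat.mono_iff_injective _).mp
    (inferInstanceAs (Mono (((toPresheaf X).map φ).app (op U))))

/-- Taking sections over `U` is left exact. -/
lemma exists_of_app_eq_zero {S : ShortComplex X.Modules} (hS : S.Exact) [Mono S.f]
    {U : X.Opens} {s : Γ(S.X₂, U)} (hs : S.g.app U s = 0) :
    ∃ t : Γ(S.X₁, U), S.f.app U t = s := by
  let F : X.Modules ⥤ Ab := toPresheaf X ⋙ (CategoryTheory.evaluation _ _).obj (op U)
  have : F.PreservesZeroMorphisms := ⟨fun _ _ ↦ rfl⟩
  have : PreservesFiniteLimits F :=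
    have : PreservesFiniteLimits (toPresheaf X) := PreservesLimitsOfSize.preservesFiniteLimits _
    have : PreservesFiniteLimits ((CategoryTheory.evaluation X.Opensᵒᵖ Ab.{u}).obj (op U)) :=
      ⟨fun _ ↦ inferInstance⟩
    comp_preservesFiniteLimits _ _
  have h := hS.map_of_mono_of_preservesKernel F inferInstance inferInstance
  exact (ShortComplex.ab_exact_iff _).mp h s hs

lemma epi_of_isLocallySurjective {φ : M ⟶ N} (h : IsLocallySurjective φ) : Epi φ where
  left_cancellation f g e := by
    ext U s
    refine eq_of_locally_eq fun x hx ↦ ?_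
    obtain ⟨V, i, hV, t, ht⟩ := h U s x hx
    refine ⟨V, i, hV, ?_⟩
    rw [← app_map, ← app_map, ← ht]
    exact congr(($e).app V t)

/-- The sections of the image of `φ` over `U`: the sections which locally lift along `φ`. -/
def imageSections (φ : M ⟶ N) (U : X.Opens) : Submodule Γ(X, U) Γ(N, U) where
  carrier := {s | ∀ x ∈ U, ∃ (V : X.Opens) (i : V ⟶ U), x ∈ V ∧
    ∃ t : Γ(M, V), φ.app V t = N.presheaf.map i.op s}
  zero_mem' := fun x hx ↦ ⟨U, 𝟙 _, hx, 0, by simp⟩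
  add_mem' := by
    intro s t hs ht x hx
    obtain ⟨V, i, hV, s', hs⟩ := hs x hx
    obtain ⟨W, j, hW, t', ht⟩ := ht x hx
    refine ⟨V ⊓ W, Opens.infLELeft V W ≫ i, ⟨hV, hW⟩,
      M.presheaf.map (Opens.infLELeft V W).op s' + M.presheaf.map (Opens.infLERight V W).op t', ?_⟩
    rw [map_add, app_map, app_map, hs, ht, map_add, map_map _ i, map_map _ j]
  smul_mem' := by
    intro r s hs x hx
    obtain ⟨V, i, hV, s', hs⟩ := hs x hx
    exact ⟨V, i, hV, X.presheaf.map i.op r • s', by rw [Hom.app_smul, hs, map_smul]⟩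

lemma map_mem_imageSections (φ : M ⟶ N) {U U' : X.Opens} (k : U' ⟶ U) {s : Γ(N, U)}
    (hs : s ∈ imageSections φ U) : N.presheaf.map k.op s ∈ imageSections φ U' := by
  intro x hx
  obtain ⟨V, i, hV, t, ht⟩ := hs x (leOfHom k hx)
  refine ⟨V ⊓ U', Opens.infLERight V U', ⟨hV, hx⟩, M.presheaf.map (Opens.infLELeft V U').op t, ?_⟩
  rw [app_map, ht, map_map _ i _ (Opens.infLELeft V U' ≫ i),
    map_map _ k _ (Opens.infLELeft V U' ≫ i)]

/-- The image of `φ` as a presheaf of submodules of the target. -/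
def imageSubmodule (φ : M ⟶ N) : PresheafOfModules.Submodule N.val where
  obj U := imageSections φ U.unop
  map i _ hs := map_mem_imageSections φ i.unop hs

/-- The image of a morphism of `𝒪_X`-modules. -/
def localImage (φ : M ⟶ N) : X.Modules where
  val := (imageSubmodule φ).toPresheafOfModules
  isSheaf := by
    refine (TopCat.Presheaf.isSheaf_iff_isSheafUniqueGluing _).mpr ?_
    intro ι U sf hsf
    let sf' (i : ι) : Γ(N, U i) := (sf i).1
    have hsf' : TopCat.Presheaf.IsCompatible N.presheaf U sf' :=
      fun i j ↦ congr_arg Subtype.val (hsf i j)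
    obtain ⟨s, hs, hs'⟩ := TopCat.Presheaf.IsSheaf.isSheafUniqueGluing N.isSheaf U sf' hsf'
    have mem : s ∈ imageSections φ (iSup U) := by
      intro x hx
      obtain ⟨i, hi⟩ := Opens.mem_iSup.mp hx
      obtain ⟨V, j, hV, t, ht⟩ := (sf i).2 x hi
      refine ⟨V, j ≫ Opens.leSupr U i, hV, t, ht.trans ?_⟩
      have := hs i
      exact (congr_arg _ this.symm).trans (map_map N (Opens.leSupr U i) j _ s)
    exact ⟨⟨s, mem⟩, fun i ↦ Subtype.ext (hs i),
      fun t ht ↦ Subtype.ext (hs' t.1 fun i ↦ congr_arg Subtype.val (ht i))⟩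

/-- The inclusion of the image of `φ` in the target. -/
def localImageι (φ : M ⟶ N) : localImage φ ⟶ N := ⟨(imageSubmodule φ).ι⟩

/-- The corestriction of `φ` to its image. -/
def toLocalImage (φ : M ⟶ N) : M ⟶ localImage φ where
  val := PresheafOfModules.homMk
    { app U := AddCommGrpCat.ofHom
        { toFun s := ⟨φ.app U.unop s, fun x hx ↦ ⟨U.unop, 𝟙 _, hx, s, by simp⟩⟩
          map_zero' := Subtype.ext (map_zero _)
          map_add' s t := Subtype.ext (map_add _ s t) }
      naturality U V i := by
        ext s
        exact Subtype.ext (app_map φ i.unop s) }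
    (fun U r s ↦ Subtype.ext (Hom.app_smul φ r s))

/-- The image of an epimorphism is a subobject of the target whose inclusion is both a
monomorphism and an epimorphism, hence an isomorphism. -/
lemma isLocallySurjective (φ : M ⟶ N) [Epi φ] : IsLocallySurjective φ := by
  have h₁ : Mono (localImageι φ) := mono_of_injective fun U ↦ Subtype.val_injective
  have h₂ : Epi (localImageι φ) := by
    have : toLocalImage φ ≫ localImageι φ = φ := rfl
    exact epi_of_epi_fac this
  have : IsIso (localImageι φ) := isIso_of_mono_of_epi _
  intro U s
  have h : IsIso ((localImageι φ).app U) := inferInstance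
  obtain ⟨t, rfl⟩ := ((ConcreteCategory.isIso_iff_bijective _).mp h).2 s
  exact Subtype.prop (p := (· ∈ imageSections φ U)) t

lemma isIso_of_bijective {φ : M ⟶ N} (h : ∀ U, Function.Bijective (φ.app U)) : IsIso φ :=
  Hom.isIso_iff_isIso_app.mpr fun U ↦ (ConcreteCategory.isIso_iff_bijective _).mpr (h U)

/-- The vanishing of the class in the cokernel is a local condition. -/
lemma exists_app_eq_of_locally (φ : M ⟶ N) [Mono φ] {U : X.Opens} {s : Γ(N, U)}
    (h : ∀ x ∈ U, ∃ (V : X.Opens) (i : V ⟶ U), x ∈ V ∧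
      ∃ t : Γ(M, V), φ.app V t = N.presheaf.map i.op s) : ∃ t : Γ(M, U), φ.app U t = s := by
  let S := ShortComplex.mk φ (cokernel.π φ) (cokernel.condition _)
  refine exists_of_app_eq_zero (S := S) (ShortComplex.exact_cokernel _) ?_
  refine eq_of_locally_eq fun x hx ↦ ?_
  obtain ⟨V, i, hV, t, ht⟩ := h x hx
  refine ⟨V, i, hV, ?_⟩
  rw [← app_map, map_zero]
  exact (congr_arg _ ht.symm).trans congr(($(cokernel.condition φ)).app V t)

/-- A sequence of `𝒪_X`-modules is short exact if it is left exact on sections and if its second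
morphism is locally surjective. -/
lemma shortExact_of_sections {S : ShortComplex X.Modules}
    (h₁ : ∀ U, Function.Injective (S.f.app U))
    (h₂ : ∀ (U : X.Opens) (s : Γ(S.X₂, U)), S.g.app U s = 0 → ∃ t : Γ(S.X₁, U), S.f.app U t = s)
    (h₃ : IsLocallySurjective S.g) : S.ShortExact := by
  have := mono_of_injective h₁
  have := epi_of_isLocallySurjective h₃
  refine { exact := ?_ }
  rw [ShortComplex.exact_iff_epi_kernel_lift]
  have : IsIso (kernel.lift S.g S.f S.zero) := by
    refine isIso_of_bijective fun U ↦ ⟨app_injective _ U, fun t ↦ ?_⟩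
    obtain ⟨r, hr⟩ := h₂ U ((kernel.ι S.g).app U t) congr(($(kernel.condition S.g)).app U t)
    refine ⟨r, app_injective (kernel.ι S.g) U ?_⟩
    rw [← hr]
    exact congr(($(kernel.lift_ι S.g S.f S.zero)).app U r)
  infer_instance

end Modules

namespace IdealSheaf

variable {X : Scheme.{u}} (𝔭 : X.IdealSheaf) (M : X.Modules)

open Modules

instance mono_smulι : Mono (𝔭.smulι M) := mono_of_injective fun _ ↦ Subtype.val_injective

instance epi_quotientπ : Epi (𝔭.quotientπ M) :=
  inferInstanceAs (Epi (cokernel.π (𝔭.smulι M)))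

lemma smulι_app_mem {U : X.Opens} (t : Γ(𝔭.smul M, U)) :
    (𝔭.smulι M).app U t ∈ 𝔭.smulSections M U :=
  Subtype.prop (p := (· ∈ 𝔭.smulSections M U)) t

lemma exists_smulι_app_eq {U : X.Opens} {s : Γ(M, U)} (hs : s ∈ 𝔭.smulSections M U) :
    ∃ t : Γ(𝔭.smul M, U), (𝔭.smulι M).app U t = s := ⟨⟨s, hs⟩, rfl⟩

lemma shortExact_smul :
    (ShortComplex.mk (𝔭.smulι M) (𝔭.quotientπ M) (𝔭.smulι_quotientπ M)).ShortExact where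
  exact := ShortComplex.exact_cokernel _
  mono_f := 𝔭.mono_smulι M
  epi_g := 𝔭.epi_quotientπ M

lemma quotientπ_app_eq_zero_iff {U : X.Opens} {s : Γ(M, U)} :
    (𝔭.quotientπ M).app U s = 0 ↔ s ∈ 𝔭.smulSections M U := by
  refine ⟨fun h ↦ ?_, 𝔭.quotientπ_app_eq_zero M⟩
  have hS := 𝔭.shortExact_smul M
  have : Mono (ShortComplex.mk (𝔭.smulι M) (𝔭.quotientπ M) (𝔭.smulι_quotientπ M)).f := hS.mono_f
  obtain ⟨t, ht⟩ := exists_of_app_eq_zero hS.exact h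
  rw [← ht]
  exact 𝔭.smulι_app_mem M t

variable {M} in
lemma app_mem_smulSections {N : X.Modules} (φ : M ⟶ N) {U : X.Opens} {s : Γ(M, U)}
    (hs : s ∈ 𝔭.smulSections M U) : φ.app U s ∈ 𝔭.smulSections N U := by
  intro x hx
  obtain ⟨V, i, hV, h⟩ := hs x hx
  refine ⟨V, i, hV, ?_⟩
  rw [← app_map]
  have : 𝔭.ideal V • (⊤ : Submodule Γ(X, V) Γ(M, V)) ≤
      (𝔭.ideal V • (⊤ : Submodule Γ(X, V) Γ(N, V))).comap (appLinear φ V) := by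
    rw [Submodule.smul_le]
    intro r hr m _
    rw [Submodule.mem_comap, LinearMap.map_smul]
    exact Submodule.smul_mem_smul hr trivial
  exact this h

end IdealSheaf

end AlgebraicGeometry.Scheme

/-! ### Finitely generated ideals and sheaves of ideals -/

/-- An ideal generated by finitely many elements multiplies componentwise on a product, since
finitely many coefficients in each component combine to finitely many families. -/
lemma Ideal.mem_smul_top_pi_of_fg {R : Type*} [CommRing R] {ι : Type*} {N : ι → Type*}
    [∀ i, AddCommGroup (N i)] [∀ i, Module R (N i)] {J : Ideal R} (hJ : J.FG) (s : ∀ i, N i)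
    (hs : ∀ i, s i ∈ J • (⊤ : Submodule R (N i))) : s ∈ J • (⊤ : Submodule R (∀ i, N i)) := by
  induction J, hJ using Submodule.fg_induction generalizing s with
  | singleton f =>
    simp only [Ideal.submodule_span_eq, Submodule.ideal_span_singleton_smul,
      Submodule.mem_smul_pointwise_iff_exists] at hs ⊢
    choose t _ ht using hs
    exact ⟨t, trivial, funext ht⟩
  | sup J₁ J₂ _ _ h₁ h₂ =>
    simp only [Submodule.sup_smul, Submodule.mem_sup] at hs ⊢
    choose a ha b hb h using hs
    exact ⟨a, h₁ a ha, b, h₂ b hb, funext h⟩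

namespace AlgebraicGeometry.Scheme

lemma presheaf_map_map {X : Scheme.{u}} {U V W : X.Opens} (i : V ⟶ U) (j : W ⟶ V) (k : W ⟶ U)
    (f : Γ(X, U)) : X.presheaf.map j.op (X.presheaf.map i.op f) = X.presheaf.map k.op f := by
  rw [← CommRingCat.comp_apply, ← Functor.map_comp, ← op_comp]
  rfl

namespace IdealSheaf

variable {X : Scheme.{u}} (𝔭 : X.IdealSheaf)

/-- The function `f` on `V` restricts, near each point of `V`, to an element of the extension of
the ideal `J` of `Γ(X, U)`. -/
def IsLocallyIn {U V : X.Opens} (i : V ⟶ U) (J : Ideal Γ(X, U)) (f : Γ(X, V)) : Prop :=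
  ∀ x ∈ V, ∃ (W : X.Opens) (j : W ⟶ V), x ∈ W ∧
    X.presheaf.map j.op f ∈ J.map (X.presheaf.map (j ≫ i).op).hom

section IsLocallyIn

variable {U V : X.Opens} {i : V ⟶ U} {J K : Ideal Γ(X, U)} {f g : Γ(X, V)}

lemma map_mem_map {W W' : X.Opens} (j : W ⟶ V) (k : W' ⟶ W)
    (h : X.presheaf.map j.op f ∈ J.map (X.presheaf.map (j ≫ i).op).hom) :
    X.presheaf.map (k ≫ j).op f ∈ J.map (X.presheaf.map ((k ≫ j) ≫ i).op).hom := by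
  have := Ideal.mem_map_of_mem (X.presheaf.map k.op).hom h
  rw [Ideal.map_map, ← CommRingCat.hom_comp, ← Functor.map_comp] at this
  rw [← presheaf_map_map j k]
  exact this

lemma IsLocallyIn.add (hf : IsLocallyIn i J f) (hg : IsLocallyIn i J g) :
    IsLocallyIn i J (f + g) := by
  intro x hx
  obtain ⟨W, j, hW, hf⟩ := hf x hx
  obtain ⟨W', j', hW', hg⟩ := hg x hx
  refine ⟨W ⊓ W', Opens.infLELeft W W' ≫ j, ⟨hW, hW'⟩, ?_⟩
  rw [map_add]
  exact add_mem (map_mem_map j _ hf) (map_mem_map j' (Opens.infLERight W W') hg)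

lemma IsLocallyIn.mul (hf : IsLocallyIn i J f) (hg : IsLocallyIn i K g) :
    IsLocallyIn i (J * K) (f * g) := by
  intro x hx
  obtain ⟨W, j, hW, hf⟩ := hf x hx
  obtain ⟨W', j', hW', hg⟩ := hg x hx
  refine ⟨W ⊓ W', Opens.infLELeft W W' ≫ j, ⟨hW, hW'⟩, ?_⟩
  rw [map_mul, Ideal.map_mul]
  exact Ideal.mul_mem_mul (map_mem_map j _ hf) (map_mem_map j' (Opens.infLERight W W') hg)

lemma isLocallyIn_of_locally (h : ∀ x ∈ V, ∃ (W : X.Opens) (j : W ⟶ V), x ∈ W ∧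
    IsLocallyIn (j ≫ i) J (X.presheaf.map j.op f)) : IsLocallyIn i J f := by
  intro x hx
  obtain ⟨W, j, hW, h⟩ := h x hx
  obtain ⟨W', j', hW', h⟩ := h x hW
  refine ⟨W', j' ≫ j, hW', ?_⟩
  rw [presheaf_map_map j j' (j' ≫ j)] at h
  simpa using h

end IsLocallyIn

/-- The ideal `J` of `Γ(X, U)` generates `𝔭` on `U`. -/
structure IsGeneratedOn (U : X.Opens) (J : Ideal Γ(X, U)) : Prop where
  le : J ≤ 𝔭.ideal U
  isLocallyIn {V : X.Opens} (i : V ⟶ U) {f : Γ(X, V)} (hf : f ∈ 𝔭.ideal V) : IsLocallyIn i J f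

/-- The sheaf of ideals is locally generated by finitely many sections. -/
def IsLocallyFG : Prop :=
  ∀ x : X, ∃ (U : X.Opens) (J : Ideal Γ(X, U)), x ∈ U ∧ J.FG ∧ 𝔭.IsGeneratedOn U J

variable {𝔭}

lemma IsGeneratedOn.pow {U : X.Opens} {J : Ideal Γ(X, U)} (h : 𝔭.IsGeneratedOn U J) (n : ℕ) :
    (𝔭.pow n).IsGeneratedOn U (J ^ n) where
  le f hf x hx := ⟨U, 𝟙 U, hx, by simpa using Ideal.pow_right_mono h.le n hf⟩
  isLocallyIn := by
    have key : ∀ (n : ℕ) {V : X.Opens} (i : V ⟶ U) (f : Γ(X, V)), f ∈ 𝔭.ideal V ^ n →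
        IsLocallyIn i (J ^ n) f := by
      intro n
      induction n with
      | zero =>
        intro V i f _ x hx
        refine ⟨V, 𝟙 V, hx, ?_⟩
        rw [pow_zero, Ideal.one_eq_top, Ideal.map_top]
        trivial
      | succ n ih =>
        intro V i f hf
        rw [pow_succ] at hf ⊢
        induction hf using Submodule.mul_induction_on' with
        | mem_mul_mem a ha b hb => exact (ih i a ha).mul (h.isLocallyIn i hb)
        | add a _ b _ ha hb => exact ha.add hb
    intro V i f hf
    refine isLocallyIn_of_locally fun x hx ↦ ?_
    obtain ⟨W, j, hW, hf⟩ := hf x hx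
    exact ⟨W, j, hW, key n _ _ hf⟩

lemma IsGeneratedOn.restrict {U V : X.Opens} (i : V ⟶ U) {J : Ideal Γ(X, U)}
    (h : 𝔭.IsGeneratedOn U J) :
    𝔭.IsGeneratedOn V (J.map (X.presheaf.map i.op).hom) where
  le := Ideal.map_le_iff_le_comap.mpr fun _ hf ↦ 𝔭.map_mem i (h.le hf)
  isLocallyIn {W} k f hf x hx := by
    obtain ⟨W', j, hW', hf⟩ := h.isLocallyIn (k ≫ i) hf x hx
    refine ⟨W', j, hW', ?_⟩
    rw [Ideal.map_map, ← CommRingCat.hom_comp, ← Functor.map_comp]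
    exact hf

lemma IsLocallyFG.pow (h : 𝔭.IsLocallyFG) (n : ℕ) : (𝔭.pow n).IsLocallyFG := by
  intro x
  obtain ⟨U, J, hU, hJ, h⟩ := h x
  exact ⟨U, J ^ n, hU, hJ.pow, h.pow n⟩

lemma IsGeneratedBy.isGeneratedOn {s : Set Γ(X, ⊤)} (h : 𝔭.IsGeneratedBy s) :
    𝔭.IsGeneratedOn ⊤ (Ideal.span s) where
  le := Ideal.span_le.mpr h.1
  isLocallyIn {V} i f hf x hx := by
    obtain ⟨W, j, hW, hf⟩ := h.2 V f hf x hx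
    refine ⟨W, j, hW, ?_⟩
    rw [Ideal.map_span]
    exact hf

variable (𝔭)

/-! ### Multiples of a sheaf of ideals in products of stalks -/

open Modules

variable (M : X.Modules)

/-- The elements of the stalk of `M` at `x` which come from the stalk of `𝔭 M`. -/
def smulStalk (x : X) : Set (M.presheaf.stalk x) :=
  {m | ∃ (V : X.Opens) (hx : x ∈ V), ∃ t ∈ 𝔭.smulSections M V, M.presheaf.germ V x hx t = m}

variable {M} in
lemma smulStalk_add {x : X} {m m' : M.presheaf.stalk x} (h : m ∈ 𝔭.smulStalk M x)
    (h' : m' ∈ 𝔭.smulStalk M x) : m + m' ∈ 𝔭.smulStalk M x := by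
  obtain ⟨V, hV, t, ht, rfl⟩ := h
  obtain ⟨V', hV', t', ht', rfl⟩ := h'
  have hx : x ∈ V ⊓ V' := ⟨hV, hV'⟩
  refine ⟨V ⊓ V', hx, _, add_mem (𝔭.map_mem_smulSections M (Opens.infLELeft V V') ht)
    (𝔭.map_mem_smulSections M (Opens.infLERight V V') ht'), ?_⟩
  rw [map_add, TopCat.Presheaf.germ_res_apply, TopCat.Presheaf.germ_res_apply]

attribute [local instance] sectionsStalkModule

variable {M} in
lemma smul_mem_smulStalk {U : X.Opens} (x : U) {r : Γ(X, U)} (hr : r ∈ 𝔭.ideal U)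
    (m : M.presheaf.stalk x.1) : r • m ∈ 𝔭.smulStalk M x.1 := by
  obtain ⟨V, hV, t, rfl⟩ := TopCat.Presheaf.exists_germ_eq M.presheaf m
  have hx : x.1 ∈ U ⊓ V := ⟨x.2, hV⟩
  refine ⟨U ⊓ V, hx, X.presheaf.map (Opens.infLELeft U V).op r •
    M.presheaf.map (Opens.infLERight U V).op t, ?_, ?_⟩
  · intro y hy
    refine ⟨_, 𝟙 _, hy, ?_⟩
    rw [Modules.map_id_apply]
    exact Submodule.smul_mem_smul (𝔭.map_mem _ hr) trivial
  · rw [Modules.germ_smul M U x _ (Opens.infLELeft U V) hx, TopCat.Presheaf.germ_res_apply]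

lemma mem_smulStalk_of_mem_smulSections {U : X.Opens} {s : Γ(M.godementZero, U)}
    (hs : s ∈ 𝔭.smulSections M.godementZero U) (x : U) :
    (show ∀ x : U, M.presheaf.stalk x.1 from s) x ∈ 𝔭.smulStalk M x.1 := by
  obtain ⟨V, i, hV, h⟩ := hs x.1 x.2
  have key : ∀ t : Γ(M.godementZero, V),
      t ∈ 𝔭.ideal V • (⊤ : Submodule Γ(X, V) Γ(M.godementZero, V)) →
      (show ∀ x : V, M.presheaf.stalk x.1 from t) ⟨x.1, hV⟩ ∈ 𝔭.smulStalk M x.1 := by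
    intro t ht
    induction ht using Submodule.smul_induction_on' with
    | smul r hr m _ => exact 𝔭.smul_mem_smulStalk (⟨x.1, hV⟩ : V) hr _
    | add a _ b _ ha hb => exact 𝔭.smulStalk_add ha hb
  exact key _ h

variable {𝔭} {M} in
/-- The stalk of `𝔭 M` at a point of `U` is generated by the multiples of the elements of `J`. -/
lemma IsGeneratedOn.mem_smul_top {U : X.Opens} {J : Ideal Γ(X, U)} (h : 𝔭.IsGeneratedOn U J)
    (x : U) {m : M.presheaf.stalk x.1} (hm : m ∈ 𝔭.smulStalk M x.1) :
    m ∈ J • (⊤ : Submodule Γ(X, U) (M.presheaf.stalk x.1)) := by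
  obtain ⟨V, hV, t, ht, rfl⟩ := hm
  obtain ⟨W, j, hW, ht⟩ := ht x.1 hV
  rw [← TopCat.Presheaf.germ_res_apply M.presheaf j x.1 hW]
  generalize M.presheaf.map j.op t = t' at ht
  induction ht using Submodule.smul_induction_on' with
  | smul r hr m _ =>
    let k := Opens.infLERight U W
    obtain ⟨W', j', hW', hr⟩ := h.isLocallyIn (Opens.infLELeft U W) (𝔭.map_mem k hr) x.1 ⟨x.2, hW⟩
    rw [presheaf_map_map k j' (j' ≫ k)] at hr
    rw [← TopCat.Presheaf.germ_res_apply M.presheaf (j' ≫ k) x.1 hW', Modules.map_smul]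
    generalize M.presheaf.map (j' ≫ k).op m = m' at *
    generalize X.presheaf.map (j' ≫ k).op r = r' at *
    refine Submodule.span_induction (p := fun r' _ ↦ ∀ m' : Γ(M, W'),
      M.presheaf.germ W' x.1 hW' (r' • m') ∈
        J • (⊤ : Submodule Γ(X, U) (M.presheaf.stalk x.1))) ?_ ?_ ?_ ?_ hr m'
    · rintro _ ⟨r, hr, rfl⟩ m'
      have := M.germ_smul U x W' (j' ≫ Opens.infLELeft U W) hW' r m'
      exact this ▸ Submodule.smul_mem_smul hr trivial
    · intro m'
      rw [zero_smul, map_zero]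
      exact Submodule.zero_mem _
    · intro a b _ _ ha hb m'
      rw [add_smul, map_add]
      exact add_mem (ha m') (hb m')
    · intro a b _ hb m'
      rw [smul_eq_mul, mul_comm, mul_smul]
      exact hb _
  | add a _ b _ ha hb =>
    rw [map_add]
    exact add_mem ha hb

variable {𝔭} {M} in
/-- The finiteness of `J` allows to choose coefficients at all the points of `U` simultaneously. -/
lemma IsGeneratedOn.mem_smul_top_godementZero {U : X.Opens} {J : Ideal Γ(X, U)}
    (h : 𝔭.IsGeneratedOn U J) (hJ : J.FG) {s : Γ(M.godementZero, U)}
    (hs : ∀ x : U, (show ∀ x : U, M.presheaf.stalk x.1 from s) x ∈ 𝔭.smulStalk M x.1) :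
    s ∈ J • (⊤ : Submodule Γ(X, U) Γ(M.godementZero, U)) :=
  Ideal.mem_smul_top_pi_of_fg (N := fun x : U ↦ M.presheaf.stalk x.1) hJ s
    fun x ↦ h.mem_smul_top x (hs x)

variable {𝔭} {M} in
/-- The sections of `𝔭 C⁰ M` are the families of elements of the stalks of `𝔭 M`. -/
lemma IsLocallyFG.mem_smulSections_godementZero_iff (h : 𝔭.IsLocallyFG) {U : X.Opens}
    {s : Γ(M.godementZero, U)} :
    s ∈ 𝔭.smulSections M.godementZero U ↔
      ∀ x : U, (show ∀ x : U, M.presheaf.stalk x.1 from s) x ∈ 𝔭.smulStalk M x.1 := by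
  refine ⟨𝔭.mem_smulStalk_of_mem_smulSections M, fun hs x hx ↦ ?_⟩
  obtain ⟨U', J, hU', hJ, hg⟩ := h x
  refine ⟨U ⊓ U', Opens.infLELeft U U', ⟨hx, hU'⟩, ?_⟩
  have hg' := hg.restrict (Opens.infLERight U U')
  refine Submodule.smul_mono_left hg'.le (hg'.mem_smul_top_godementZero (hJ.map _) fun y ↦ ?_)
  exact hs ⟨y.1, y.2.1⟩

end IdealSheaf

end AlgebraicGeometry.Scheme

namespace AlgebraicGeometry.Scheme.IdealSheaf

/-! ### Coherent sheaves of ideals on affine open subsets -/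

variable {X : Scheme.{u}} (𝔭 : X.IdealSheaf)

/-- On `U`, the sheaf of ideals is the sheaf associated with a finitely generated ideal of
`Γ(X, U)`. The basic open subsets are only given up to equality, so that those of a basic open
subset of `U` can be regarded as basic open subsets of `U`. -/
def IsTildeOn (U : X.Opens) : Prop :=
  (𝔭.ideal U).FG ∧ ∀ {W : X.Opens} (i : W ⟶ U) (f : Γ(X, U)), W = X.basicOpen f →
    𝔭.ideal W = (𝔭.ideal U).map (X.presheaf.map i.op).hom

variable {𝔭}

lemma IsTildeOn.basicOpen {U : X.Opens} (hU : IsAffineOpen U) (h : 𝔭.IsTildeOn U) (f : Γ(X, U)) :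
    𝔭.IsTildeOn (X.basicOpen f) := by
  have e := h.2 (homOfLE (X.basicOpen_le f)) f rfl
  refine ⟨e ▸ h.1.map _, fun {W} i g hW ↦ ?_⟩
  obtain ⟨f', hf'⟩ := hU.basicOpen_basicOpen_is_basicOpen f g
  rw [e, h.2 (i ≫ homOfLE (X.basicOpen_le f)) f' (hW.trans hf'.symm), Ideal.map_map,
    ← CommRingCat.hom_comp, ← Functor.map_comp, ← op_comp]

variable (𝔭) in
lemma mem_of_span_eq_top {U : X.Opens} (hU : IsAffineOpen U) {t : Set Γ(X, U)}
    (ht : Ideal.span t = ⊤) {F : Γ(X, U)}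
    (h : ∀ g ∈ t, X.presheaf.map (homOfLE (X.basicOpen_le g)).op F ∈ 𝔭.ideal (X.basicOpen g)) :
    F ∈ 𝔭.ideal U := by
  refine 𝔭.mem_of_locally fun x hx ↦ ?_
  have := hU.self_le_iSup_basicOpen_iff.mpr ht hx
  obtain ⟨g, hg⟩ := Opens.mem_iSup.mp this
  exact ⟨_, homOfLE (X.basicOpen_le g.1), hg, h g g.2⟩

/-- If `f ^ n s` extends to a section `F` over `U`, then on each `D(g)`, a multiple of `F` by a
power of `f` belongs to `𝔭`; a common power works for the finitely many `g`. -/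
lemma ideal_eq_map_of_cover {U : X.Opens} (hU : IsAffineOpen U) {t : Finset Γ(X, U)}
    (ht : Ideal.span (t : Set Γ(X, U)) = ⊤) (h : ∀ g ∈ t, 𝔭.IsTildeOn (X.basicOpen g))
    {W : X.Opens} (i : W ⟶ U) (f : Γ(X, U)) (hW : W = X.basicOpen f) :
    𝔭.ideal W = (𝔭.ideal U).map (X.presheaf.map i.op).hom := by
  refine le_antisymm (fun s hs ↦ ?_) (Ideal.map_le_iff_le_comap.mpr fun _ hf ↦ 𝔭.map_mem i hf)
  let := (X.presheaf.map i.op).hom.toAlgebra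
  have loc : IsLocalization.Away f Γ(X, W) := hU.isLocalization_of_eq_basicOpen f i hW
  obtain ⟨⟨F, ⟨_, n, rfl⟩⟩, hF⟩ := IsLocalization.surj (Submonoid.powers f) s
  have key : ∀ g ∈ t, ∃ m : ℕ, X.presheaf.map (homOfLE (X.basicOpen_le g)).op (f ^ m * F) ∈
      𝔭.ideal (X.basicOpen g) := by
    intro g hg
    let k : X.basicOpen g ⟶ U := homOfLE (X.basicOpen_le g)
    let j : X.basicOpen g ⊓ W ⟶ X.basicOpen g := Opens.infLELeft _ _
    have hj : X.basicOpen g ⊓ W = X.basicOpen (X.presheaf.map k.op f) := by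
      rw [X.basicOpen_res, hW]
    have mem : X.presheaf.map j.op (X.presheaf.map k.op F) ∈ 𝔭.ideal (X.basicOpen g ⊓ W) := by
      have := 𝔭.map_mem (Opens.infLERight (X.basicOpen g) W)
        (Ideal.mul_mem_right (X.presheaf.map i.op (f ^ n)) _ hs)
      have hF' : s * X.presheaf.map i.op (f ^ n) = X.presheaf.map i.op F := hF
      rw [hF', presheaf_map_map i _ (j ≫ k)] at this
      rwa [presheaf_map_map k j (j ≫ k)]
    rw [(h g hg).2 j _ hj] at mem
    let := (X.presheaf.map j.op).hom.toAlgebra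
    have loc' : IsLocalization.Away (X.presheaf.map k.op f) Γ(X, X.basicOpen g ⊓ W) :=
      (hU.basicOpen g).isLocalization_of_eq_basicOpen _ j hj
    obtain ⟨_, ⟨m, rfl⟩, hm⟩ := (IsLocalization.algebraMap_mem_map_algebraMap_iff
      (Submonoid.powers (X.presheaf.map k.op f)) Γ(X, X.basicOpen g ⊓ W) (𝔭.ideal (X.basicOpen g))
      (X.presheaf.map k.op F)).mp mem
    refine ⟨m, ?_⟩
    rw [map_mul, map_pow]
    exact hm
  choose! m hm using key
  have hF' : f ^ t.sup m * F ∈ 𝔭.ideal U := by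
    refine 𝔭.mem_of_span_eq_top hU ht fun g hg ↦ ?_
    rw [← Nat.sub_add_cancel (Finset.le_sup (f := m) hg), pow_add, mul_assoc, map_mul]
    exact Ideal.mul_mem_left _ _ (hm g hg)
  refine (IsLocalization.mem_map_algebraMap_iff (Submonoid.powers f) Γ(X, W)).mpr
    ⟨⟨⟨_, hF'⟩, ⟨_, n + t.sup m, rfl⟩⟩, ?_⟩
  dsimp only at hF ⊢
  rw [pow_add, map_mul, ← mul_assoc, hF, map_mul, mul_comm]

lemma isTildeOn_of_cover {U : X.Opens} (hU : IsAffineOpen U) {t : Finset Γ(X, U)}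
    (ht : Ideal.span (t : Set Γ(X, U)) = ⊤) (h : ∀ g ∈ t, 𝔭.IsTildeOn (X.basicOpen g)) :
    𝔭.IsTildeOn U := by
  refine ⟨Ideal.fg_of_localizationSpan _ ht fun g ↦ ?_, fun i f hW ↦
    ideal_eq_map_of_cover hU ht h i f hW⟩
  have e := ideal_eq_map_of_cover hU ht h (homOfLE (X.basicOpen_le g.1)) g.1 rfl
  let := (X.presheaf.map (homOfLE (X.basicOpen_le g.1)).op).hom.toAlgebra
  have loc : IsLocalization.Away g.1 Γ(X, X.basicOpen g.1) := hU.isLocalization_basicOpen g.1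
  have fg : ((𝔭.ideal U).map (algebraMap Γ(X, U) Γ(X, X.basicOpen g.1))).FG := e ▸ (h g.1 g.2).1
  have := fg.map (IsLocalization.algEquiv (Submonoid.powers g.1) Γ(X, X.basicOpen g.1)
    (Localization.Away g.1)).toAlgHom.toRingHom
  rw [Ideal.map_map] at this
  convert! this
  exact (AlgHom.comp_algebraMap (IsLocalization.algEquiv (Submonoid.powers g.1)
    Γ(X, X.basicOpen g.1) (Localization.Away g.1)).toAlgHom).symm

lemma IsCoherent.isTildeOn (h : 𝔭.IsCoherent) {U : X.Opens} (hU : IsAffineOpen U) :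
    𝔭.IsTildeOn U := by
  choose V hV hx hV' using h
  refine of_affine_open_cover (P := fun U ↦ 𝔭.IsTildeOn U.1) (fun x : X ↦ ⟨V x, hV x⟩)
    (eq_top_iff.mpr fun x _ ↦ Opens.mem_iSup.mpr ⟨x, hx x⟩) ⟨U, hU⟩
    (fun U f hU ↦ hU.basicOpen U.2 f) (fun U t ht h ↦ isTildeOn_of_cover U.2 ht
      fun g hg ↦ h ⟨g, hg⟩) fun x ↦ ⟨(hV' x).1, fun i f hW ↦ ?_⟩
  subst hW
  exact (hV' x).2 f

lemma IsTildeOn.isGeneratedOn {U : X.Opens} (hU : IsAffineOpen U) (h : 𝔭.IsTildeOn U) :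
    𝔭.IsGeneratedOn U (𝔭.ideal U) where
  le := le_rfl
  isLocallyIn {V} i f hf x hx := by
    obtain ⟨g, hg, hxg⟩ := hU.exists_basicOpen_le ⟨x, hx⟩ (leOfHom i hx)
    refine ⟨_, homOfLE hg, hxg, ?_⟩
    rw [← h.2 _ g rfl]
    exact 𝔭.map_mem _ hf

lemma IsCoherent.isLocallyFG (h : 𝔭.IsCoherent) : 𝔭.IsLocallyFG := by
  intro x
  obtain ⟨U, hU, hx, hfg, -⟩ := h x
  exact ⟨U, _, hx, hfg, (h.isTildeOn hU).isGeneratedOn hU⟩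

end AlgebraicGeometry.Scheme.IdealSheaf

namespace AlgebraicGeometry.Scheme

variable {X : Scheme.{u}}

namespace Modules

variable {M N K : X.Modules}

/-! ### Exactness of the terms of the Godement resolution -/

/-- The map induced on stalks by a morphism of `𝒪_X`-modules. -/
def stalkMap (φ : M ⟶ N) (x : X) : M.presheaf.stalk x ⟶ N.presheaf.stalk x :=
  (TopCat.Presheaf.stalkFunctor Ab x).map φ.mapPresheaf

lemma stalkMap_germ (φ : M ⟶ N) {U : X.Opens} {x : X} (hx : x ∈ U) (s : Γ(M, U)) :
    stalkMap φ x (M.presheaf.germ U x hx s) = N.presheaf.germ U x hx (φ.app U s) :=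
  TopCat.Presheaf.stalkFunctor_map_germ_apply U x hx φ.mapPresheaf s

lemma exists_map_eq_zero_of_germ_eq_zero {U : X.Opens} {x : X} (hx : x ∈ U) {s : Γ(M, U)}
    (hs : M.presheaf.germ U x hx s = 0) :
    ∃ (V : X.Opens) (i : V ⟶ U), x ∈ V ∧ M.presheaf.map i.op s = 0 := by
  obtain ⟨V, hV, i, j, h⟩ := TopCat.Presheaf.germ_eq M.presheaf x hx hx s 0 (by rw [hs, map_zero])
  exact ⟨V, i, hV, by rw [h, map_zero]⟩

lemma stalkMap_injective (φ : M ⟶ N) [Mono φ] (x : X) : Function.Injective (stalkMap φ x) := by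
  rw [injective_iff_map_eq_zero]
  intro m hm
  obtain ⟨U, hU, s, rfl⟩ := TopCat.Presheaf.exists_germ_eq M.presheaf m
  rw [stalkMap_germ] at hm
  obtain ⟨V, i, hV, h⟩ := exists_map_eq_zero_of_germ_eq_zero hU hm
  rw [← app_map] at h
  have h' : M.presheaf.map i.op s = 0 := app_injective φ V (by rw [h, map_zero])
  rw [← TopCat.Presheaf.germ_res_apply M.presheaf i x hV, h', map_zero]

lemma stalkMap_surjective (φ : M ⟶ N) [Epi φ] (x : X) : Function.Surjective (stalkMap φ x) := by
  intro n
  obtain ⟨U, hU, s, rfl⟩ := TopCat.Presheaf.exists_germ_eq N.presheaf n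
  obtain ⟨V, i, hV, t, ht⟩ := isLocallySurjective φ U s x hU
  refine ⟨M.presheaf.germ V x hV t, ?_⟩
  rw [stalkMap_germ, ht, TopCat.Presheaf.germ_res_apply]

lemma exists_of_stalkMap_eq_zero {S : ShortComplex X.Modules} (hS : S.Exact) [Mono S.f] {x : X}
    {m : S.X₂.presheaf.stalk x} (hm : stalkMap S.g x m = 0) : ∃ n, stalkMap S.f x n = m := by
  obtain ⟨U, hU, s, rfl⟩ := TopCat.Presheaf.exists_germ_eq S.X₂.presheaf m
  rw [stalkMap_germ] at hm
  obtain ⟨V, i, hV, h⟩ := exists_map_eq_zero_of_germ_eq_zero hU hm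
  rw [← app_map] at h
  obtain ⟨t, ht⟩ := exists_of_app_eq_zero hS h
  refine ⟨S.X₁.presheaf.germ V x hV t, ?_⟩
  rw [stalkMap_germ, ht, TopCat.Presheaf.germ_res_apply]

lemma godementZeroMap_app_injective (φ : M ⟶ N) [Mono φ] (U : X.Opens) :
    Function.Injective ((godementZeroMap φ).app U) := by
  intro s t h
  funext x
  exact stalkMap_injective φ x.1 (congr_fun h x)

lemma godementZeroMap_app_surjective (φ : M ⟶ N) [Epi φ] (U : X.Opens) :
    Function.Surjective ((godementZeroMap φ).app U) := by
  intro s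
  choose t ht using fun x : U ↦ stalkMap_surjective φ x.1 ((show ∀ x : U, _ from s) x)
  exact ⟨t, funext ht⟩

lemma godementZeroMap_zero : godementZeroMap (0 : M ⟶ N) = 0 := by
  ext U s
  funext x
  obtain ⟨V, hV, t, ht⟩ := TopCat.Presheaf.exists_germ_eq M.presheaf
    ((show ∀ x : U, M.presheaf.stalk x.1 from s) x)
  refine (congr_arg (stalkMap (0 : M ⟶ N) x.1) ht.symm).trans ?_
  rw [stalkMap_germ]
  exact map_zero _

/-- The functor `F` preserves short exact sequences. -/
def PreservesShortExact (F : X.Modules ⥤ X.Modules) : Prop :=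
  ∀ ⦃N M K : X.Modules⦄ ⦃f : N ⟶ M⦄ ⦃g : M ⟶ K⦄ (w : f ≫ g = 0),
    (ShortComplex.mk f g w).ShortExact →
    ∃ w' : F.map f ≫ F.map g = 0, (ShortComplex.mk (F.map f) (F.map g) w').ShortExact

lemma preservesShortExact_godementZeroFunctor :
    PreservesShortExact (godementZeroFunctor (X := X)) := by
  intro N M K f g w hS
  have : Mono f := hS.mono_f
  have : Epi g := hS.epi_g
  have w' : godementZeroMap f ≫ godementZeroMap g = 0 := by
    rw [← godementZeroMap_comp, w, godementZeroMap_zero]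
  refine ⟨w', shortExact_of_sections (godementZeroMap_app_injective f) (fun U s hs ↦ ?_)
    (fun U s x hx ↦ ?_)⟩
  · choose t ht using fun x : U ↦ exists_of_stalkMap_eq_zero hS.exact (congr_fun hs x)
    exact ⟨t, funext ht⟩
  · obtain ⟨t, ht⟩ := godementZeroMap_app_surjective g U s
    exact ⟨U, 𝟙 U, hx, t, ht.trans (map_id_apply _ _ _).symm⟩

instance mono_toGodementZero (M : X.Modules) : Mono M.toGodementZero :=
  mono_of_injective fun U s t h ↦
    TopCat.Presheaf.section_ext M.abSheaf U s t fun x hx ↦ congr_fun h ⟨x, hx⟩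

/-- The projection of `C⁰ M` onto the cokernel `M₁` of `M ⟶ C⁰ M`. -/
def godementCokernelπ (M : X.Modules) : M.godementZero ⟶ godementCokernel.obj M :=
  cokernel.π M.toGodementZero

instance epi_godementCokernelπ (M : X.Modules) : Epi (godementCokernelπ M) :=
  inferInstanceAs (Epi (cokernel.π M.toGodementZero))

lemma godementCokernelπ_naturality (φ : M ⟶ N) :
    godementCokernelπ M ≫ godementCokernel.map φ = godementZeroMap φ ≫ godementCokernelπ N :=
  cokernel.π_desc _ _ _

lemma toGodementZero_cokernelπ (M : X.Modules) : M.toGodementZero ≫ godementCokernelπ M = 0 :=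
  cokernel.condition _

lemma exact_toGodementZero (M : X.Modules) :
    (ShortComplex.mk _ _ M.toGodementZero_cokernelπ).Exact :=
  ShortComplex.exact_cokernel _

lemma exists_of_godementCokernelπ_eq_zero {U : X.Opens} {s : Γ(M.godementZero, U)}
    (hs : (godementCokernelπ M).app U s = 0) : ∃ t : Γ(M, U), M.toGodementZero.app U t = s :=
  have : Mono (ShortComplex.mk _ _ M.toGodementZero_cokernelπ).f := M.mono_toGodementZero
  exists_of_app_eq_zero M.exact_toGodementZero hs

/-- This is the snake lemma for the monomorphisms `M ⟶ C⁰ M`. -/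
lemma preservesShortExact_godementCokernel :
    PreservesShortExact (godementCokernel (X := X)) := by
  intro N M K f g w hS
  obtain ⟨w₀ : godementZeroMap f ≫ godementZeroMap g = 0, -⟩ :=
    preservesShortExact_godementZeroFunctor w hS
  have : Mono f := hS.mono_f
  have : Mono (ShortComplex.mk f g w).f := hS.mono_f
  have : Epi g := hS.epi_g
  have w' : godementCokernel.map f ≫ godementCokernel.map g = 0 := by
    rw [← cancel_epi (godementCokernelπ N), ← Category.assoc, godementCokernelπ_naturality,
      Category.assoc, godementCokernelπ_naturality, ← Category.assoc, w₀, zero_comp, comp_zero]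
  have nat {M N : X.Modules} (φ : M ⟶ N) (U : X.Opens) (t : Γ(M.godementZero, U)) :
      (godementCokernel.map φ).app U ((godementCokernelπ M).app U t) =
        (godementCokernelπ N).app U ((godementZeroMap φ).app U t) :=
    congr(($(godementCokernelπ_naturality φ)).app U t)
  have nat' {M N : X.Modules} (φ : M ⟶ N) (U : X.Opens) (t : Γ(M, U)) :
      N.toGodementZero.app U (φ.app U t) = (godementZeroMap φ).app U (M.toGodementZero.app U t) :=
    congr(($(toGodementZero_naturality φ)).app U t)
  have hπ (M : X.Modules) (U : X.Opens) (t : Γ(M, U)) :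
      (godementCokernelπ M).app U (M.toGodementZero.app U t) = 0 :=
    congr(($(M.toGodementZero_cokernelπ)).app U t)
  have inj (U : X.Opens) : Function.Injective ((godementCokernel.map f).app U) := by
    rw [injective_iff_map_eq_zero]
    intro s hs
    refine eq_of_locally_eq fun x hx ↦ ?_
    obtain ⟨V, i, hV, t, ht⟩ := isLocallySurjective (godementCokernelπ N) U s x hx
    refine ⟨V, i, hV, ?_⟩
    rw [← ht, map_zero]
    -- The image of `t` in `C⁰ M` comes from a section `m` of `M`, which dies in `K` because it
    -- dies in `C⁰ K`.
    obtain ⟨m, hm⟩ : ∃ m : Γ(M, V), M.toGodementZero.app V m = (godementZeroMap f).app V t := by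
      apply exists_of_godementCokernelπ_eq_zero
      rw [← nat, ht, app_map, hs, map_zero]
    obtain ⟨n, rfl⟩ : ∃ n : Γ(N, V), f.app V n = m := by
      refine exists_of_app_eq_zero hS.exact (app_injective K.toGodementZero V ?_)
      rw [map_zero]
      refine (nat' g V m).trans ?_
      rw [hm]
      exact congr(($w₀).app V t)
    rw [nat'] at hm
    rw [← godementZeroMap_app_injective f V hm, hπ]
  have := mono_of_injective inj
  refine ⟨w', shortExact_of_sections inj (fun U s hs ↦ ?_) ?_⟩
  · refine exists_app_eq_of_locally _ fun x hx ↦ ?_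
    obtain ⟨V, i, hV, t, ht⟩ := isLocallySurjective (godementCokernelπ M) U s x hx
    dsimp only at hs ht ⊢
    -- The lift `t` of `s` to `C⁰ M` maps to the germs of a section `k` of `K`; subtracting from `t`
    -- the germs of a lift `m` of `k` gives a lift which comes from `C⁰ N`.
    obtain ⟨k, hk⟩ : ∃ k : Γ(K, V), K.toGodementZero.app V k = (godementZeroMap g).app V t := by
      apply exists_of_godementCokernelπ_eq_zero
      rw [← nat, ht, app_map, hs, map_zero]
    obtain ⟨W, j, hW, m, hm⟩ := isLocallySurjective g V k x hV
    obtain ⟨_, h₀⟩ := preservesShortExact_godementZeroFunctor w hS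
    have := h₀.mono_f
    obtain ⟨n, hn⟩ := exists_of_app_eq_zero h₀.exact
      (s := M.godementZero.presheaf.map j.op t - M.toGodementZero.app W m) (by
        change (godementZeroMap g).app W _ = 0
        rw [map_sub, ← nat', hm, app_map, app_map, hk, sub_self])
    refine ⟨W, j ≫ i, hW, (godementCokernelπ N).app W n, ?_⟩
    refine (nat f W n).trans ((congr_arg _ hn).trans ?_)
    rw [map_sub, hπ, sub_zero, app_map, ht, map_map]
  · have : Epi (godementZeroMap g ≫ godementCokernelπ K) := by
      have := (preservesShortExact_godementZeroFunctor w hS).2.epi_g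
      have : Epi (godementZeroMap g) := this
      infer_instance
    have : Epi (godementCokernel.map g) := epi_of_epi_fac (godementCokernelπ_naturality g)
    exact isLocallySurjective _

end Modules

end AlgebraicGeometry.Scheme

namespace AlgebraicGeometry.Scheme.IdealSheaf

variable {X : Scheme.{u}} (𝔭 : X.IdealSheaf)

open Modules

/-! ### Functors which commute with multiplication by a sheaf of ideals -/

/-- The functor `F` preserves short exact sequences and `𝔭 F(M)` is the image of `F(𝔭 M)`.
This property is stable under composition. -/
structure CommutesWithSmul (F : X.Modules ⥤ X.Modules) : Prop where
  preservesShortExact : PreservesShortExact F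
  exists_iso (M : X.Modules) : ∃ e : 𝔭.smul (F.obj M) ≅ F.obj (𝔭.smul M),
    e.hom ≫ F.map (𝔭.smulι M) = 𝔭.smulι (F.obj M)

variable {𝔭}

lemma exists_iso_smul {M N : X.Modules} (φ : N ⟶ M) [Mono φ]
    (h : ∀ (U : X.Opens) (s : Γ(M, U)), s ∈ 𝔭.smulSections M U ↔ ∃ t : Γ(N, U), φ.app U t = s) :
    ∃ e : 𝔭.smul M ≅ N, e.hom ≫ φ = 𝔭.smulι M := by
  have hS := 𝔭.shortExact_smul M
  have : Mono (ShortComplex.mk _ _ (𝔭.smulι_quotientπ M)).f := hS.mono_f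
  have w : φ ≫ 𝔭.quotientπ M = 0 := by
    ext U t
    exact (𝔭.quotientπ_app_eq_zero_iff M).mpr ((h U _).mpr ⟨t, rfl⟩)
  have fac : hS.exact.lift φ w ≫ 𝔭.smulι M = φ := hS.exact.lift_f φ w
  have inj (U : X.Opens) : Function.Injective ((hS.exact.lift φ w).app U) := by
    have : Mono (hS.exact.lift φ w) := mono_of_mono_fac fac
    exact app_injective _ U
  have : IsIso (hS.exact.lift φ w) := by
    refine isIso_of_bijective fun U ↦ ⟨inj U, fun t ↦ ?_⟩
    obtain ⟨r, hr⟩ := (h U _).mp (𝔭.smulι_app_mem M t)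
    exact ⟨r, app_injective (𝔭.smulι M) U (congr(($fac).app U r).trans hr)⟩
  exact ⟨(asIso (hS.exact.lift φ w)).symm, (Iso.inv_comp_eq (asIso _)).mpr fac.symm⟩

namespace CommutesWithSmul

variable {F G : X.Modules ⥤ X.Modules}

lemma id : 𝔭.CommutesWithSmul (𝟭 X.Modules) where
  preservesShortExact _ _ _ _ _ w h := ⟨w, h⟩
  exists_iso _ := ⟨Iso.refl _, Category.id_comp _⟩

lemma comp (hF : 𝔭.CommutesWithSmul F) (hG : 𝔭.CommutesWithSmul G) :
    𝔭.CommutesWithSmul (F ⋙ G) where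
  preservesShortExact _ _ _ _ _ w h :=
    let ⟨w', h'⟩ := hF.preservesShortExact w h
    hG.preservesShortExact w' h'
  exists_iso M := by
    obtain ⟨e, he⟩ := hF.exists_iso M
    obtain ⟨e', he'⟩ := hG.exists_iso (F.obj M)
    refine ⟨e' ≪≫ G.mapIso e, ?_⟩
    rw [Iso.trans_hom, Category.assoc, Functor.mapIso_hom, Functor.comp_map, ← G.map_comp, he, he']
    rfl

lemma exists_quotient_iso (hF : 𝔭.CommutesWithSmul F) (M : X.Modules) :
    ∃ e : 𝔭.quotient (F.obj M) ≅ F.obj (𝔭.quotient M),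
      𝔭.quotientπ (F.obj M) ≫ e.hom = F.map (𝔭.quotientπ M) := by
  obtain ⟨e, he⟩ := hF.exists_iso M
  obtain ⟨w, hS⟩ := hF.preservesShortExact _ (𝔭.shortExact_smul M)
  have : Epi (ShortComplex.mk _ _ w).g := hS.epi_g
  have : Epi (F.map (𝔭.quotientπ M)) := hS.epi_g
  have w₁ : 𝔭.smulι (F.obj M) ≫ F.map (𝔭.quotientπ M) = 0 := by
    rw [← he, Category.assoc, w, comp_zero]
  have w₂ : F.map (𝔭.smulι M) ≫ 𝔭.quotientπ (F.obj M) = 0 := by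
    rw [← cancel_epi e.hom, ← Category.assoc, he, smulι_quotientπ, comp_zero]
  have fac₁ : 𝔭.quotientπ (F.obj M) ≫ cokernel.desc _ _ w₁ = F.map (𝔭.quotientπ M) :=
    cokernel.π_desc _ _ _
  have fac₂ : F.map (𝔭.quotientπ M) ≫ hS.exact.desc _ w₂ = 𝔭.quotientπ (F.obj M) :=
    hS.exact.g_desc _ w₂
  refine ⟨⟨cokernel.desc _ _ w₁, hS.exact.desc _ w₂, ?_, ?_⟩, fac₁⟩
  · rw [← cancel_epi (𝔭.quotientπ (F.obj M))]
    exact (Category.assoc _ _ _).symm.trans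
      ((congr_arg (· ≫ _) fac₁).trans (fac₂.trans (Category.comp_id _).symm))
  · rw [← cancel_epi (F.map (𝔭.quotientπ M))]
    exact (Category.assoc _ _ _).symm.trans
      ((congr_arg (· ≫ _) fac₂).trans (fac₁.trans (Category.comp_id _).symm))

end CommutesWithSmul

lemma mem_smulStalk_iff {M : X.Modules} {x : X} {m : M.presheaf.stalk x} :
    m ∈ 𝔭.smulStalk M x ↔ ∃ n, stalkMap (𝔭.smulι M) x n = m := by
  constructor
  · rintro ⟨V, hV, t, ht, rfl⟩
    obtain ⟨t, rfl⟩ := 𝔭.exists_smulι_app_eq M ht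
    exact ⟨_, stalkMap_germ _ hV t⟩
  · rintro ⟨n, rfl⟩
    obtain ⟨V, hV, t, rfl⟩ := TopCat.Presheaf.exists_germ_eq (𝔭.smul M).presheaf n
    exact ⟨V, hV, _, 𝔭.smulι_app_mem M t, (stalkMap_germ _ hV t).symm⟩

lemma IsLocallyFG.commutesWithSmul_godementZeroFunctor (h : 𝔭.IsLocallyFG) :
    𝔭.CommutesWithSmul godementZeroFunctor where
  preservesShortExact := preservesShortExact_godementZeroFunctor
  exists_iso M := by
    have : Mono (godementZeroMap (𝔭.smulι M)) :=
      mono_of_injective (godementZeroMap_app_injective _)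
    refine exists_iso_smul (godementZeroMap (𝔭.smulι M)) fun U s ↦ ?_
    rw [h.mem_smulSections_godementZero_iff]
    simp only [mem_smulStalk_iff]
    constructor
    · intro h
      choose t ht using h
      exact ⟨t, funext ht⟩
    · rintro ⟨t, rfl⟩ x
      exact ⟨_, rfl⟩

lemma exists_lift_of_mem_smul_top {M N : X.Modules} {φ : M ⟶ N} (hφ : IsLocallySurjective φ)
    {U : X.Opens} {s : Γ(N, U)} (hs : s ∈ 𝔭.ideal U • (⊤ : Submodule Γ(X, U) Γ(N, U))) :
    ∀ x ∈ U, ∃ (V : X.Opens) (i : V ⟶ U), x ∈ V ∧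
      ∃ t ∈ 𝔭.smulSections M V, φ.app V t = N.presheaf.map i.op s := by
  intro x hx
  induction hs using Submodule.smul_induction_on' with
  | smul r hr n _ =>
    obtain ⟨V, i, hV, t, ht⟩ := hφ U n x hx
    refine ⟨V, i, hV, X.presheaf.map i.op r • t, fun y hy ↦ ⟨V, 𝟙 V, hy, ?_⟩, ?_⟩
    · rw [map_id_apply]
      exact Submodule.smul_mem_smul (𝔭.map_mem i hr) trivial
    · rw [Hom.app_smul, ht, map_smul]
  | add a _ b _ ha hb =>
    obtain ⟨V, i, hV, t, ht, h⟩ := ha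
    obtain ⟨V', i', hV', t', ht', h'⟩ := hb
    refine ⟨V ⊓ V', Opens.infLELeft V V' ≫ i, ⟨hV, hV'⟩, _,
      add_mem (𝔭.map_mem_smulSections M (Opens.infLELeft V V') ht)
        (𝔭.map_mem_smulSections M (Opens.infLERight V V') ht'), ?_⟩
    rw [map_add, map_add, app_map, app_map, h, h', map_map _ i, map_map _ i']

lemma IsLocallyFG.commutesWithSmul_godementCokernel (h : 𝔭.IsLocallyFG) :
    𝔭.CommutesWithSmul godementCokernel where
  preservesShortExact := preservesShortExact_godementCokernel
  exists_iso M := by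
    have : Mono (godementCokernel.map (𝔭.smulι M)) :=
      (preservesShortExact_godementCokernel _ (𝔭.shortExact_smul M)).2.mono_f
    obtain ⟨e, he⟩ : ∃ e : 𝔭.smul M.godementZero ≅ (𝔭.smul M).godementZero,
        e.hom ≫ godementZeroMap (𝔭.smulι M) = 𝔭.smulι M.godementZero :=
      h.commutesWithSmul_godementZeroFunctor.exists_iso M
    have nat (U : X.Opens) (t : Γ((𝔭.smul M).godementZero, U)) :
        (godementCokernel.map (𝔭.smulι M)).app U ((godementCokernelπ _).app U t) =
          (godementCokernelπ M).app U ((godementZeroMap (𝔭.smulι M)).app U t) :=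
      congr(($(godementCokernelπ_naturality (𝔭.smulι M))).app U t)
    refine exists_iso_smul (godementCokernel.map (𝔭.smulι M)) fun U s ↦ ⟨fun hs ↦ ?_, ?_⟩
    · refine exists_app_eq_of_locally _ fun x hx ↦ ?_
      obtain ⟨V, i, hV, hs⟩ := hs x hx
      obtain ⟨W, j, hW, t, ht, hts⟩ :=
        exists_lift_of_mem_smul_top (isLocallySurjective (godementCokernelπ M)) hs x hV
      obtain ⟨t, rfl⟩ := 𝔭.exists_smulι_app_eq _ ht
      refine ⟨W, j ≫ i, hW, (godementCokernelπ _).app W (e.hom.app W t), ?_⟩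
      rw [nat, ← map_map _ i j, ← hts]
      exact congr_arg _ congr(($he).app W t)
    · rintro ⟨t, rfl⟩
      refine 𝔭.mem_smulSections_of_locally _ fun x hx ↦ ?_
      obtain ⟨V, i, hV, r, hr⟩ := isLocallySurjective (godementCokernelπ (𝔭.smul M)) U t x hx
      refine ⟨V, i, hV, ?_⟩
      rw [← app_map, ← hr, nat]
      refine 𝔭.app_mem_smulSections _ ?_
      have he' : godementZeroMap (𝔭.smulι M) = e.inv ≫ 𝔭.smulι M.godementZero :=
        (Iso.eq_inv_comp e).mpr he
      rw [he']
      exact 𝔭.smulι_app_mem _ (e.inv.app V r)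

lemma IsLocallyFG.commutesWithSmul_godement (h : 𝔭.IsLocallyFG) (i : ℕ) :
    𝔭.CommutesWithSmul (godement i) := by
  have syz (i : ℕ) : 𝔭.CommutesWithSmul (godementSyzygy i) := by
    induction i with
    | zero => exact .id
    | succ i ih => exact ih.comp h.commutesWithSmul_godementCokernel
  exact (syz i).comp h.commutesWithSmul_godementZeroFunctor

end AlgebraicGeometry.Scheme.IdealSheaf

namespace AlgebraicGeometry.Scheme

variable {X : Scheme.{u}}

namespace Modules

/-! ### Extension by zero of discontinuous sections -/

open Classical in
/-- The extension by zero of a discontinuous section. -/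
def extendByZero (M : X.Modules) {V : X.Opens} (U : X.Opens) :
    Γ(M.godementZero, V) →+ Γ(M.godementZero, U) where
  toFun s := fun x : U ↦ if h : x.1 ∈ V then (show ∀ x : V, _ from s) ⟨x.1, h⟩ else 0
  map_zero' := by
    funext x
    by_cases h : x.1 ∈ V
    · exact dif_pos h
    · exact dif_neg h
  map_add' s t := by
    funext x
    by_cases h : x.1 ∈ V
    · refine (dif_pos h).trans (.symm (congr_arg₂ _ ?_ ?_)) <;> exact dif_pos h
    · refine (dif_neg h).trans (.symm ((congr_arg₂ _ ?_ ?_).trans (add_zero _))) <;> exact dif_neg h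

lemma map_extendByZero (M : X.Modules) {U V : X.Opens} (i : V ⟶ U) (s : Γ(M.godementZero, V)) :
    M.godementZero.presheaf.map i.op (extendByZero M U s) = s := by
  funext x
  exact dif_pos x.2

lemma isFlasque_of_surjective {M : X.Modules}
    (h : ∀ {U V : X.Opens} (i : V ⟶ U), Function.Surjective (M.presheaf.map i.op)) :
    TopCat.Presheaf.IsFlasque M.presheaf where
  epi i := (AddCommGrpCat.epi_iff_surjective _).mpr (h i.unop)

lemma godementZero_map_surjective (M : X.Modules) {U V : X.Opens} (i : V ⟶ U) :
    Function.Surjective (M.godementZero.presheaf.map i.op) :=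
  fun s ↦ ⟨_, map_extendByZero M i s⟩

lemma isAcyclicOn_of_isFlasque {M : X.Modules} (h : TopCat.Presheaf.IsFlasque M.presheaf)
    (U : X.Opens) : M.IsAcyclicOn U := fun _ hj ↦
  have : TopCat.Sheaf.IsFlasque (M.abSheaf : TopCat.Sheaf AddCommGrpCat.{u} X) := h
  TopCat.Sheaf.subsingleton_H'_of_isFlasque M.abSheaf U hj

end Modules

namespace IdealSheaf

open Modules

variable {𝔭 : X.IdealSheaf} {M : X.Modules}

lemma IsLocallyFG.extendByZero_mem (h : 𝔭.IsLocallyFG) {U V : X.Opens} {s : Γ(M.godementZero, V)}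
    (hs : s ∈ 𝔭.smulSections M.godementZero V) :
    extendByZero M U s ∈ 𝔭.smulSections M.godementZero U := by
  rw [h.mem_smulSections_godementZero_iff] at hs ⊢
  intro x
  by_cases hx : x.1 ∈ V
  · have : (show ∀ x : U, M.presheaf.stalk x.1 from extendByZero M U s) x =
      (show ∀ x : V, M.presheaf.stalk x.1 from s) ⟨x.1, hx⟩ := dif_pos hx
    rw [this]
    exact hs ⟨x.1, hx⟩
  · have : (show ∀ x : U, M.presheaf.stalk x.1 from extendByZero M U s) x = 0 := dif_neg hx
    rw [this]
    exact ⟨U, x.2, 0, Submodule.zero_mem _, map_zero _⟩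

/-! ### Acyclicity -/

lemma IsLocallyFG.quotientπ_godementZero_surjective (h : 𝔭.IsLocallyFG) (M : X.Modules)
    (U : X.Opens) : Function.Surjective ((𝔭.quotientπ M.godementZero).app U) := by
  obtain ⟨e, he⟩ : ∃ e : 𝔭.quotient M.godementZero ≅ (𝔭.quotient M).godementZero,
      𝔭.quotientπ M.godementZero ≫ e.hom = godementZeroMap (𝔭.quotientπ M) :=
    h.commutesWithSmul_godementZeroFunctor.exists_quotient_iso M
  intro s
  obtain ⟨t, ht⟩ := godementZeroMap_app_surjective (𝔭.quotientπ M) U (e.hom.app U s)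
  rw [← he] at ht
  exact ⟨t, app_injective e.hom U ht⟩

lemma IsLocallyFG.isFlasque_quotient_godementZero (h : 𝔭.IsLocallyFG) (M : X.Modules) :
    TopCat.Presheaf.IsFlasque (𝔭.quotient M.godementZero).presheaf :=
  isFlasque_of_surjective fun {U V} i s ↦ by
    obtain ⟨t, rfl⟩ := h.quotientπ_godementZero_surjective M V s
    obtain ⟨t, rfl⟩ := godementZero_map_surjective M i t
    exact ⟨_, (app_map _ i t).symm⟩

/-- The ideal `Jⁿ`, which generates `𝔭ⁿ` on `U`, is contained in `Γ(U, 𝔭)ⁿ`. Hence the sections of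
`𝔭ⁿ C⁰ M` over `U` are combinations of sections of `C⁰ M` with coefficients in `Γ(U, 𝔭)ⁿ`. -/
lemma IsLocallyFG.sectionsQuotientMap_bijective (h : 𝔭.IsLocallyFG) {U : X.Opens}
    {J : Ideal Γ(X, U)} (hJ : J.FG) (hU : 𝔭.IsGeneratedOn U J) (M : X.Modules) (n : ℕ) :
    Function.Bijective (𝔭.sectionsQuotientMap M.godementZero n U) := by
  constructor
  · rw [← LinearMap.ker_eq_bot]
    refine Submodule.ker_liftQ_eq_bot _ _ _ fun s hs ↦ ?_
    have hs' : s ∈ (𝔭.pow n).smulSections M.godementZero U :=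
      (quotientπ_app_eq_zero_iff _ _).mp hs
    exact Submodule.smul_mono_left (Ideal.pow_right_mono hU.le n)
      ((hU.pow n).mem_smul_top_godementZero hJ.pow (mem_smulStalk_of_mem_smulSections _ _ hs'))
  · intro s
    obtain ⟨t, rfl⟩ := (h.pow n).quotientπ_godementZero_surjective M U s
    exact ⟨Submodule.Quotient.mk t, rfl⟩

theorem IsCoherent.isAffinelyAcyclic_godementZero (h : 𝔭.IsCoherent) (M : X.Modules) :
    𝔭.IsAffinelyAcyclic M.godementZero := fun U hU n ↦
  ⟨isAcyclicOn_of_isFlasque (isFlasque_of_surjective (godementZero_map_surjective M)) U,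
    isAcyclicOn_of_isFlasque ((h.isLocallyFG.pow n).isFlasque_quotient_godementZero M) U,
    (h.isLocallyFG.sectionsQuotientMap_bijective (h.isTildeOn hU).1
      ((h.isTildeOn hU).isGeneratedOn hU) M n).comp
      (TensorProduct.tensorQuotEquivQuotSMul _ (𝔭.ideal U ^ n)).bijective⟩

/-! ### Sections of the completion -/

variable (𝔭) (M)

lemma quotientπ_transition (n : ℕ) :
    (𝔭.pow (n + 1)).quotientπ M ≫ 𝔭.transition M n = (𝔭.pow n).quotientπ M :=
  cokernel.π_desc _ _ _

lemma tower_map_succ (n : ℕ) :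
    (𝔭.tower M).map (homOfLE (Nat.le_add_right n 1)).op = 𝔭.transition M n :=
  Functor.ofOpSequence_map_homOfLE_succ _ n

lemma completionπ_transition (n : ℕ) :
    𝔭.completionπ M (n + 1) ≫ 𝔭.transition M n = 𝔭.completionπ M n := by
  have := limit.w (𝔭.tower M) (homOfLE (Nat.le_add_right n 1)).op
  rwa [tower_map_succ] at this

/-- The functor of sections over `U`. -/
def sectionsFunctor (U : X.Opens) : X.Modules ⥤ Type u :=
  toPresheaf X ⋙ (CategoryTheory.evaluation X.Opensᵒᵖ Ab.{u}).obj (op U) ⋙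
    CategoryTheory.forget AddCommGrpCat.{u}

instance (U : X.Opens) : PreservesLimitsOfSize.{0, 0} (sectionsFunctor U) := by
  have : PreservesLimits (sectionsFunctor U) := by
    have : PreservesLimits ((CategoryTheory.evaluation X.Opensᵒᵖ Ab.{u}).obj (op U)) :=
      inferInstance
    have : PreservesLimits ((CategoryTheory.evaluation X.Opensᵒᵖ Ab.{u}).obj (op U) ⋙
      CategoryTheory.forget AddCommGrpCat.{u}) := comp_preservesLimits _ _
    exact comp_preservesLimits _ _
  exact preservesLimitsOfSize_shrink _

variable {M} in
lemma completion_ext {U : X.Opens} {s t : Γ(𝔭.completion M, U)}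
    (h : ∀ n, (𝔭.completionπ M n).app U s = (𝔭.completionπ M n).app U t) : s = t := by
  have hl := isLimitOfPreserves (sectionsFunctor U) (limit.isLimit (𝔭.tower M))
  refine (Types.isLimitEquivSections hl).injective (Subtype.ext (funext fun n ↦ ?_))
  exact h n.unop

variable {M} in
lemma exists_completion {U : X.Opens} (s : ∀ n, Γ((𝔭.pow n).quotient M, U))
    (hs : ∀ n, (𝔭.transition M n).app U (s (n + 1)) = s n) :
    ∃ t : Γ(𝔭.completion M, U), ∀ n, (𝔭.completionπ M n).app U t = s n := by
  have hl := isLimitOfPreserves (sectionsFunctor U) (limit.isLimit (𝔭.tower M))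
  let c : Cone (𝔭.tower M ⋙ sectionsFunctor U) :=
    { pt := PUnit
      π := NatTrans.ofOpSequence (fun n ↦ ↾fun _ ↦ s n) fun n ↦ by
        ext
        rw [Functor.comp_map, tower_map_succ]
        exact (hs n).symm }
  exact ⟨hl.lift c PUnit.unit, fun n ↦ congr($(hl.fac c (op n)) PUnit.unit)⟩

variable {𝔭} in
/-- The differences of successive lifts of a section of the completion to `C⁰ M` are sections of
`𝔭ⁿ C⁰ M`, and so are their extensions by zero. -/
theorem IsLocallyFG.isFlasque_completion (h : 𝔭.IsLocallyFG) :
    TopCat.Presheaf.IsFlasque (𝔭.completion M.godementZero).presheaf :=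
  isFlasque_of_surjective fun {U V} i s ↦ by
    choose t ht using fun n ↦ (h.pow n).quotientπ_godementZero_surjective M V
      ((𝔭.completionπ M.godementZero n).app V s)
    have hπ (n : ℕ) {W : X.Opens} (r : Γ(M.godementZero, W)) :
        (𝔭.transition M.godementZero n).app W (((𝔭.pow (n + 1)).quotientπ _).app W r) =
          ((𝔭.pow n).quotientπ _).app W r :=
      congr(($(𝔭.quotientπ_transition M.godementZero n)).app W r)
    obtain ⟨r, hr⟩ := 𝔭.exists_completion
      (fun n ↦ ((𝔭.pow n).quotientπ M.godementZero).app U (extendByZero M U (t n))) fun n ↦ by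
        rw [hπ, ← sub_eq_zero, ← map_sub, ← map_sub, quotientπ_app_eq_zero_iff]
        refine (h.pow n).extendByZero_mem ?_
        rw [← quotientπ_app_eq_zero_iff, map_sub, sub_eq_zero, ht, ← hπ, ht]
        exact congr(($(𝔭.completionπ_transition M.godementZero n)).app V s)
    refine ⟨r, 𝔭.completion_ext fun n ↦ ?_⟩
    rw [app_map, hr, ← app_map, map_extendByZero, ht]

lemma transition_sectionsQuotientMap (n : ℕ) (U : X.Opens)
    (s : Γ(M, U) ⧸ (𝔭.ideal U ^ (n + 1) • (⊤ : Submodule Γ(X, U) Γ(M, U)))) :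
    (𝔭.transition M n).app U (𝔭.sectionsQuotientMap M (n + 1) U s) =
      𝔭.sectionsQuotientMap M n U (AdicCompletion.transitionMap _ _ n.le_succ s) := by
  obtain ⟨s, rfl⟩ := Submodule.Quotient.mk_surjective _ s
  exact congr(($(𝔭.quotientπ_transition M n)).app U s)

/-- If all the maps `Γ(U, M) / Iⁿ Γ(U, M) → Γ(U, M / 𝔭ⁿ M)` are bijective, then taking sections
over `U` commutes with completion. -/
theorem exists_adicCompletion_equiv (U : X.Opens)
    (h : ∀ n, Function.Bijective (𝔭.sectionsQuotientMap M n U)) :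
    ∃ e : AdicCompletion (𝔭.ideal U) Γ(M, U) ≃ₗ[Γ(X, U)] Γ(𝔭.completion M, U),
      ∀ (n : ℕ) (s : AdicCompletion (𝔭.ideal U) Γ(M, U)),
        (𝔭.completionπ M n).app U (e s) =
          𝔭.sectionsQuotientMap M n U (AdicCompletion.eval (𝔭.ideal U) _ n s) := by
  have ex (s : AdicCompletion (𝔭.ideal U) Γ(M, U)) :=
    𝔭.exists_completion (fun n ↦ 𝔭.sectionsQuotientMap M n U (AdicCompletion.eval _ _ n s))
      fun n ↦ by
        rw [transition_sectionsQuotientMap]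
        exact congr_arg _ (AdicCompletion.transitionMap_comp_eval_apply _ _ n.le_succ s)
  choose e he using ex
  let e' : AdicCompletion (𝔭.ideal U) Γ(M, U) →ₗ[Γ(X, U)] Γ(𝔭.completion M, U) :=
    { toFun := e
      map_add' s t := 𝔭.completion_ext fun n ↦ by rw [map_add, he, he, he, map_add, map_add]
      map_smul' r s := 𝔭.completion_ext fun n ↦ by
        rw [Hom.app_smul, he, he, LinearMap.map_smul, LinearMap.map_smul, RingHom.id_apply] }
  refine ⟨.ofBijective e' ⟨?_, fun t ↦ ?_⟩, fun n s ↦ he s n⟩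
  · intro s t hst
    refine AdicCompletion.ext fun n ↦ (h n).1 ?_
    have hst' : e s = e t := hst
    exact (he s n).symm.trans (hst' ▸ he t n)
  · choose s hs using fun n ↦ (h n).2 ((𝔭.completionπ M n).app U t)
    have hs' (n : ℕ) : AdicCompletion.transitionMap (𝔭.ideal U) _ n.le_succ (s (n + 1)) = s n := by
      apply (h n).1
      rw [← transition_sectionsQuotientMap, hs, hs]
      exact congr(($(𝔭.completionπ_transition M n)).app U t)
    refine ⟨⟨s, fun {m n} hmn ↦ ?_⟩, 𝔭.completion_ext fun n ↦ (he _ n).trans (hs n)⟩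
    induction n, hmn using Nat.le_induction with
    | base =>
      obtain ⟨r, hr⟩ := Submodule.Quotient.mk_surjective _ (s m)
      rw [← hr]
      exact Submodule.factor_mk _ r
    | succ n hmn ih =>
      rw [← ih, ← hs' n]
      exact (Submodule.factor_comp_apply _ _ _).symm

end IdealSheaf

end AlgebraicGeometry.Scheme
end

theorem mainTheorem3 (X : Scheme.{u}) (𝔭 : X.IdealSheaf) (h𝔭 : 𝔭.IsCoherent) (M : X.Modules) :
    (∀ i : ℕ,
      (∃ e : 𝔭.smul ((Scheme.Modules.godement i).obj M) ≅
          (Scheme.Modules.godement i).obj (𝔭.smul M),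
        e.hom ≫ (Scheme.Modules.godement i).map (𝔭.smulι M) =
          𝔭.smulι ((Scheme.Modules.godement i).obj M)) ∧
      (∃ e : 𝔭.quotient ((Scheme.Modules.godement i).obj M) ≅
          (Scheme.Modules.godement i).obj (𝔭.quotient M),
        𝔭.quotientπ ((Scheme.Modules.godement i).obj M) ≫ e.hom =
          (Scheme.Modules.godement i).map (𝔭.quotientπ M))) ∧
    𝔭.IsAffinelyAcyclic ((Scheme.Modules.godement 0).obj M) ∧
    TopCat.Presheaf.IsFlasque (𝔭.completion ((Scheme.Modules.godement 0).obj M)).presheaf ∧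
    ((∃ s : Set Γ(X, ⊤), s.Finite ∧ 𝔭.IsGeneratedBy s) →
      ∃ e : AdicCompletion (𝔭.ideal ⊤) Γ((Scheme.Modules.godement 0).obj M, ⊤) ≃ₗ[Γ(X, ⊤)]
          Γ(𝔭.completion ((Scheme.Modules.godement 0).obj M), ⊤),
        ∀ (n : ℕ) (s : AdicCompletion (𝔭.ideal ⊤) Γ((Scheme.Modules.godement 0).obj M, ⊤)),
          (𝔭.completionπ ((Scheme.Modules.godement 0).obj M) n).app ⊤ (e s) =
            𝔭.sectionsQuotientMap ((Scheme.Modules.godement 0).obj M) n ⊤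
              (AdicCompletion.eval (𝔭.ideal ⊤) _ n s)) := by
  have hfg := h𝔭.isLocallyFG
  refine ⟨fun i ↦ ⟨(hfg.commutesWithSmul_godement i).exists_iso M,
    (hfg.commutesWithSmul_godement i).exists_quotient_iso M⟩,
    h𝔭.isAffinelyAcyclic_godementZero M, hfg.isFlasque_completion M, ?_⟩
  rintro ⟨s, hs, hgen⟩
  exact 𝔭.exists_adicCompletion_equiv M.godementZero ⊤
    (hfg.sectionsQuotientMap_bijective (Submodule.fg_span hs) hgen.isGeneratedOn M)
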